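/- Let $k$ be a field, $\lambda\in k^\times$, $\eta\in k$, and let $0\neq\varphi\in k[z]$. Let $\sigma$ be the automorphism of $k[z]$ with $\sigma(z)=\lambda z+\eta$, and let $A=k[z;\lambda,\eta,\varphi(z)]$ be the generalized Weyl algebra generated over $k[z]$ by $x,y$ subject to $xb=\sigma(b)x$, $yb=\sigma^{-1}(b)y$ ($b\in k[z]$), $yx=\varphi(z)$, $xy=\sigma(\varphi(z))$. Let $A^e=A\otimes A^{\mathrm{op}}$, and regard $A\otimes A$ as the free $A^e$-module with $(a_1\otimes a_2)\cdot(u\otimes v)=a_1u\otimes va_2$. A homotopy double chain complex is a family of objects $P_{pq}$ ($p,q\in\mathbb Z$) with morphisms $d^v,d^h,r$ of degrees $(0,-1),(-1,0),(-2,1)$ such that $$d^vd^v=0,\quad d^hd^v+d^vd^h=0,\quad d^hd^h+d^vr+rd^v=0,\quad d^hr+rd^h=0,\quad r^2=0;$$ its total complex is $(\operatorname{Tot}P)_n=\bigoplus_{p+q=n}P_{pq}$ with differential $d^v+d^h+r$. Put $P_{00}=P_{01}=A\otimes A$, $P_{p0}=P_{p1}=(A\otimes A)^{\oplus2}$ for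 $p\ge1$, and $P_{pq}=0$ otherwise. Let $\Delta_0\colon k[z]\to k[z]\otimes k[z]$ be the linear map with $\Delta_0(z^n)=\sum_{i=1}^n z^{n-i}\otimes z^{i-1}$ (so $\Delta_0(1)=0$), and for linear endomorphisms $f,g$ of $k[z]$ let ${}^f\!\Delta^g$ be $(f\otimes g)\circ\Delta_0$ followed by the map $k[z]\otimes k[z]\to A\otimes A$ (identity maps are omitted from the notation). Define $A^e$-linear maps $d^v_p\colon P_{p1}\to P_{p0}$, $d^h_{pq}\colon P_{pq}\to P_{p-1,q}$ ($q=0,1$), $r_p\colon P_{p0}\to P_{p-2,1}$ as follows, all other components being zero; on $P_{pq}$ with $p\geq 1$ the two values are those at the generators $(1\otimes1,0)$ and $(0,1\otimes1)$, in this order, and $j\ge1$: - $d^v_0(1\otimes1)=z\otimes1-1\otimes z$; - $d^v_{2j-1}$: $(\sigma(z)\otimes1-1\otimes z,\,0)$ and $(0,\,\sigma^{-1}(z)\otimes1-1\otimes z)$; - $d^v_{2j}$: $(z\otimes1-1\otimes z,\,0)$ and $(0,\,z\otimes1-1\otimes z)$; - $d^h_{10}$: $x\otimes1-1\otimes x$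 and $y\otimes1-1\otimes y$; - $d^h_{2j,0}$: $(y\otimes1,\,1\otimes x)$ and $(1\otimes y,\,x\otimes1)$; - $d^h_{2j+1,0}$: $(x\otimes1,\,-1\otimes x)$ and $(-1\otimes y,\,y\otimes1)$; - $d^h_{11}$: $-x\otimes1+\lambda\otimes x$ and $-y\otimes1+\lambda^{-1}\otimes y$; - $d^h_{2j,1}$: $(-y\otimes1,\,-\lambda\otimes x)$ and $(-\lambda^{-1}\otimes y,\,-x\otimes1)$; - $d^h_{2j+1,1}$: $(-x\otimes1,\,\lambda\otimes x)$ and $(\lambda^{-1}\otimes y,\,-y\otimes1)$; - $r_2$: $-\Delta(\varphi)$ and $-\lambda\,{}^{\sigma}\!\Delta^{\sigma}(\varphi)$; - $r_{2j+1}$: $(-{}^{\sigma}\!\Delta(\varphi),\,0)$ and $(0,\,-\lambda\,\Delta^{\sigma}(\varphi))$; - $r_{2j+2}$: $(-\Delta(\varphi),\,0)$ and $(0,\,-\lambda\,{}^{\sigma}\!\Delta^{\sigma}(\varphi))$. Then all $P_{pq}$ are free $A^e$-modules, $(P_{\cdot\cdot},d^v,d^h,r)$ is a homotopy double chain complex,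 and $\operatorname{Tot}P_{\cdot\cdot}$ is a projective $A^e$-resolution of $A$, with augmentation $P_{00}=A\otimes A\to A$, $u\otimes v\mapsto uv$. -/

import Mathlib

open CategoryTheory CategoryTheory.Limits Polynomial TensorProduct

universe u

/-! ### Homotopy double complexes and their total complexes -/

/-- The data of a homotopy double chain complex in a preadditive category: a family of objects
`X (p, q)`, `p q : ℤ`, with morphisms `dv`, `dh`, `r` of degrees `(0, -1)`, `(-1, 0)`, `(-2, 1)`.
A morphism of degree `g` is encoded as a family `X a ⟶ X b` which vanishes unless `b = a + g`. -/
structure HomotopyDoubleData (C : Type*) [Category C] [Preadditive C] where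
  X : ℤ × ℤ → C
  dv : ∀ a b : ℤ × ℤ, X a ⟶ X b
  dh : ∀ a b : ℤ × ℤ, X a ⟶ X b
  r : ∀ a b : ℤ × ℤ, X a ⟶ X b
  dv_shape : ∀ a b, b ≠ (a.1, a.2 - 1) → dv a b = 0
  dh_shape : ∀ a b, b ≠ (a.1 - 1, a.2) → dh a b = 0
  r_shape : ∀ a b, b ≠ (a.1 - 2, a.2 + 1) → r a b = 0

/-- The five equations `dv² = 0`, `dh dv + dv dh = 0`, `dh² + dv r + r dv = 0`,
`dh r + r dh = 0`, `r² = 0` which make such data into a homotopy double chain complex. -/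
structure HomotopyDoubleData.IsHomotopyDoubleComplex {C : Type*} [Category C] [Preadditive C]
    (D : HomotopyDoubleData C) : Prop where
  dv_dv : ∀ p q : ℤ, D.dv (p, q) (p, q - 1) ≫ D.dv (p, q - 1) (p, q - 2) = 0
  dh_dv : ∀ p q : ℤ, D.dv (p, q) (p, q - 1) ≫ D.dh (p, q - 1) (p - 1, q - 1) +
    D.dh (p, q) (p - 1, q) ≫ D.dv (p - 1, q) (p - 1, q - 1) = 0
  dh_dh : ∀ p q : ℤ, D.dh (p, q) (p - 1, q) ≫ D.dh (p - 1, q) (p - 2, q) +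
    D.r (p, q) (p - 2, q + 1) ≫ D.dv (p - 2, q + 1) (p - 2, q) +
    D.dv (p, q) (p, q - 1) ≫ D.r (p, q - 1) (p - 2, q) = 0
  dh_r : ∀ p q : ℤ, D.r (p, q) (p - 2, q + 1) ≫ D.dh (p - 2, q + 1) (p - 3, q + 1) +
    D.dh (p, q) (p - 1, q) ≫ D.r (p - 1, q) (p - 3, q + 1) = 0
  r_r : ∀ p q : ℤ, D.r (p, q) (p - 2, q + 1) ≫ D.r (p - 2, q + 1) (p - 4, q + 2) = 0

namespace HomotopyDoubleData

variable {C : Type*} [Category C] [Preadditive C] [HasCoproducts.{0} C] (D : HomotopyDoubleData C)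

/-- `Tot_n = ⨁_{p + q = n} X (p, q)`. -/
noncomputable def totX (n : ℤ) : C := ∐ fun a : {a : ℤ × ℤ // a.1 + a.2 = n} => D.X a.1

/-- The inclusion of the summand `X a` into `Tot_n`, where `a = (p, q)` with `p + q = n`. -/
noncomputable def totι (n : ℤ) (a : ℤ × ℤ) (h : a.1 + a.2 = n) : D.X a ⟶ D.totX n :=
  Sigma.ι (fun a : {a : ℤ × ℤ // a.1 + a.2 = n} => D.X a.1) ⟨a, h⟩

/-- The differential `dv + dh + r` of the total complex. -/
noncomputable def totd (n m : ℤ) (h : m + 1 = n) : D.totX n ⟶ D.totX m :=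
  Sigma.desc fun a =>
    D.dv a.1 (a.1.1, a.1.2 - 1) ≫ D.totι m (a.1.1, a.1.2 - 1) (by have := a.2; dsimp; omega) +
    D.dh a.1 (a.1.1 - 1, a.1.2) ≫ D.totι m (a.1.1 - 1, a.1.2) (by have := a.2; dsimp; omega) +
    D.r a.1 (a.1.1 - 2, a.1.2 + 1) ≫ D.totι m (a.1.1 - 2, a.1.2 + 1)
      (by have := a.2; dsimp; omega)

theorem totι_totd (n m : ℤ) (h : m + 1 = n) (p q : ℤ) (ha : p + q = n)
    (a₁ a₂ a₃ : ℤ × ℤ) (h₁ : a₁ = (p, q - 1)) (h₂ : a₂ = (p - 1, q)) (h₃ : a₃ = (p - 2, q + 1)) :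
    D.totι n (p, q) ha ≫ D.totd n m h =
      D.dv (p, q) a₁ ≫ D.totι m a₁ (by subst h₁; dsimp; omega) +
      D.dh (p, q) a₂ ≫ D.totι m a₂ (by subst h₂; dsimp; omega) +
      D.r (p, q) a₃ ≫ D.totι m a₃ (by subst h₃; dsimp; omega) := by
  subst h₁ h₂ h₃
  unfold totι totd
  exact Sigma.ι_desc _ (⟨(p, q), ha⟩ : {a : ℤ × ℤ // a.1 + a.2 = n})

theorem totd_totd (hD : D.IsHomotopyDoubleComplex) (n m l : ℤ) (h : m + 1 = n) (h' : l + 1 = m) :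
    D.totd n m h ≫ D.totd m l h' = 0 := by
  refine Sigma.hom_ext _ _ ?_
  rintro ⟨⟨p, q⟩, ha⟩
  dsimp at ha
  change D.totι n (p, q) ha ≫ D.totd n m h ≫ D.totd m l h' = _ ≫ 0
  rw [← Category.assoc, D.totι_totd n m h p q ha _ _ _ rfl rfl rfl, Limits.comp_zero]
  simp only [Preadditive.add_comp, Category.assoc]
  rw [D.totι_totd m l h' p (q - 1) (by omega) (p, q - 2) (p - 1, q - 1) (p - 2, q)
      (by ext <;> simp; omega) rfl (by ext <;> simp),
    D.totι_totd m l h' (p - 1) q (by omega) (p - 1, q - 1) (p - 2, q) (p - 3, q + 1)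
      rfl (by ext <;> simp; omega) (by ext <;> simp; omega),
    D.totι_totd m l h' (p - 2) (q + 1) (by omega) (p - 2, q) (p - 3, q + 1) (p - 4, q + 2)
      (by ext <;> simp) (by ext <;> simp; omega) (by ext <;> simp <;> omega)]
  simp only [Preadditive.comp_add, ← Category.assoc]
  have e₁ := congrArg (· ≫ D.totι l (p, q - 2) (by dsimp; omega)) (hD.dv_dv p q)
  have e₂ := congrArg (· ≫ D.totι l (p - 1, q - 1) (by dsimp; omega)) (hD.dh_dv p q)
  have e₃ := congrArg (· ≫ D.totι l (p - 2, q) (by dsimp; omega)) (hD.dh_dh p q)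
  have e₄ := congrArg (· ≫ D.totι l (p - 3, q + 1) (by dsimp; omega)) (hD.dh_r p q)
  have e₅ := congrArg (· ≫ D.totι l (p - 4, q + 2) (by dsimp; omega)) (hD.r_r p q)
  simp only [Preadditive.add_comp, Limits.zero_comp] at e₁ e₂ e₃ e₄ e₅
  have e := congrArg₂ (· + ·) e₁ (congrArg₂ (· + ·) e₂ (congrArg₂ (· + ·) e₃
    (congrArg₂ (· + ·) e₄ e₅)))
  simp only [add_zero] at e
  rw [← e]
  abel

open Classical in
/-- The total complex of a homotopy double chain complex. -/
noncomputable def tot (hD : D.IsHomotopyDoubleComplex) : ChainComplex C ℤ where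
  X := D.totX
  d n m := if h : m + 1 = n then D.totd n m h else 0
  shape n m h := dif_neg h
  d_comp_d' n m l h h' := by
    rw [ComplexShape.down_Rel] at h h'
    rw [dif_pos h, dif_pos h']
    exact D.totd_totd hD n m l h h'

end HomotopyDoubleData

/-- A chain complex `K` together with an augmentation `π : K ⟶ Z[0]` is a projective resolution
of `Z`: `K` has projective terms, vanishes in negative degrees, and `π` is a quasi-isomorphism. -/
structure IsProjectiveResolution {C : Type*} [Category C] [Abelian C] {Z : C}
    (K : ChainComplex C ℤ)
    (π : K ⟶ (HomologicalComplex.single C (ComplexShape.down ℤ) 0).obj Z) : Prop where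
  projective : ∀ n, Projective (K.X n)
  isZero : ∀ n < 0, IsZero (K.X n)
  quasiIso : QuasiIso π

/-! ### Generalized Weyl algebras -/

/-- The generators of `B(σ, a)`: the elements of `B` and two variables `x`, `y`. -/
inductive GWAGen (B : Type*)
  | base (b : B)
  | x
  | y

namespace GWA

section
variable {k : Type u} [CommRing k] {B : Type u} [Ring B] [Algebra k B]

/-- The defining relations of `B(σ, a)`. The first four say that `B` maps to the quotient by a
homomorphism of `k`-algebras. -/
inductive Rel (σ : B ≃ₐ[k] B) (a : B) :
    FreeAlgebra k (GWAGen B) → FreeAlgebra k (GWAGen B) → Prop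
  | add (b c : B) : Rel σ a (FreeAlgebra.ι k (.base (b + c)))
      (FreeAlgebra.ι k (.base b) + FreeAlgebra.ι k (.base c))
  | mul (b c : B) : Rel σ a (FreeAlgebra.ι k (.base (b * c)))
      (FreeAlgebra.ι k (.base b) * FreeAlgebra.ι k (.base c))
  | algebraMap (t : k) : Rel σ a (FreeAlgebra.ι k (.base (algebraMap k B t)))
      (algebraMap k (FreeAlgebra k (GWAGen B)) t)
  | one : Rel σ a (FreeAlgebra.ι k (.base 1)) 1
  | x_base (b : B) : Rel σ a (FreeAlgebra.ι k .x * FreeAlgebra.ι k (.base b))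
      (FreeAlgebra.ι k (.base (σ b)) * FreeAlgebra.ι k .x)
  | y_base (b : B) : Rel σ a (FreeAlgebra.ι k .y * FreeAlgebra.ι k (.base b))
      (FreeAlgebra.ι k (.base (σ.symm b)) * FreeAlgebra.ι k .y)
  | y_x : Rel σ a (FreeAlgebra.ι k .y * FreeAlgebra.ι k .x) (FreeAlgebra.ι k (.base a))
  | x_y : Rel σ a (FreeAlgebra.ι k .x * FreeAlgebra.ι k .y) (FreeAlgebra.ι k (.base (σ a)))

end

end GWA

/-- The generalized Weyl algebra `B(σ, a)` (used for central `a`): the `k`-algebra generated by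
`x`, `y` over `B` subject to `x b = σ(b) x`, `y b = σ⁻¹(b) y`, `y x = a`, `x y = σ(a)`. -/
def GWA {k : Type u} [CommRing k] {B : Type u} [Ring B] [Algebra k B] (σ : B ≃ₐ[k] B) (a : B) :
    Type u :=
  RingQuot (GWA.Rel σ a)

namespace GWA

section
variable {k : Type u} [CommRing k] {B : Type u} [Ring B] [Algebra k B] (σ : B ≃ₐ[k] B) (a : B)

noncomputable instance : Ring (GWA σ a) := inferInstanceAs (Ring (RingQuot (GWA.Rel σ a)))

noncomputable instance : Algebra k (GWA σ a) :=
  inferInstanceAs (Algebra k (RingQuot (GWA.Rel σ a)))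

/-- The quotient map from the free algebra. -/
noncomputable def mk : FreeAlgebra k (GWAGen B) →ₐ[k] GWA σ a := RingQuot.mkAlgHom k (GWA.Rel σ a)

/-- The generator `x`. -/
noncomputable def x : GWA σ a := mk σ a (FreeAlgebra.ι k .x)

/-- The generator `y`. -/
noncomputable def y : GWA σ a := mk σ a (FreeAlgebra.ι k .y)

theorem mk_rel {s t : FreeAlgebra k (GWAGen B)} (h : Rel σ a s t) : mk σ a s = mk σ a t :=
  RingQuot.mkAlgHom_rel k h

/-- The canonical algebra map `B → B(σ, a)`. -/
noncomputable def ofBase : B →ₐ[k] GWA σ a where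
  toFun b := mk σ a (FreeAlgebra.ι k (.base b))
  map_one' := by rw [mk_rel σ a .one, map_one]
  map_mul' b c := by rw [mk_rel σ a (.mul b c), map_mul]
  map_zero' := by
    have h := mk_rel σ a (.add 0 0)
    rw [add_zero, map_add] at h
    exact left_eq_add.mp h
  map_add' b c := by rw [mk_rel σ a (.add b c), map_add]
  commutes' t := by rw [mk_rel σ a (.algebraMap t), AlgHom.commutes]

end

end GWA

/-! ### Enveloping algebras -/

/-- The enveloping algebra `Aᵉ = A ⊗ Aᵒᵖ`. As a left module over itself it is the bimodule
`A ⊗ A` with outer actions, `u ⊗ v` corresponding to `u ⊗ op v`. -/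
abbrev Env (k : Type u) [CommRing k] (A : Type u) [Ring A] [Algebra k A] : Type u :=
  A ⊗[k] Aᵐᵒᵖ

/-- `A` as a left `Aᵉ`-module: `(a₁ ⊗ op a₂) • m = a₁ * m * a₂`. -/
noncomputable instance envModule (k : Type u) [CommRing k] (A : Type u) [Ring A] [Algebra k A] :
    Module (Env k A) A :=
  TensorProduct.Algebra.module

theorem env_smul_def {k : Type u} [CommRing k] {A : Type u} [Ring A] [Algebra k A] (a₁ a₂ m : A) :
    (a₁ ⊗ₜ[k] MulOpposite.op a₂ : Env k A) • m = a₁ * m * a₂ := by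
  change a₁ * (m * a₂) = a₁ * m * a₂
  rw [mul_assoc]

/-- The element `u ⊗ v` of `A ⊗ A`, regarded as an element of `Aᵉ`. -/
def bt (k : Type u) [CommRing k] {A : Type u} [Ring A] [Algebra k A] (u v : A) : Env k A :=
  u ⊗ₜ[k] MulOpposite.op v

/-! ### The algebra `k[z; λ, η, φ(z)]` and its homotopy double complex -/

namespace PolyGWA

variable {k : Type u} [Field k]

/-- The automorphism `z ↦ λ z + η` of `k[z]`. -/
noncomputable def sigma (lam : kˣ) (eta : k) : k[X] ≃ₐ[k] k[X] :=
  letI := lam.invertible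
  algEquivCMulXAddC (lam : k) eta

theorem sigma_X (lam : kˣ) (eta : k) : sigma lam eta X = C (lam : k) * X + C eta := by
  simp [sigma]

/-- The linear map `Δ₀ : k[z] → k[z] ⊗ k[z]`, `z ^ n ↦ ∑_{i = 1}^{n} z ^ (n - i) ⊗ z ^ (i - 1)`. -/
noncomputable def delta₀ : k[X] →ₗ[k] k[X] ⊗[k] k[X] :=
  (Polynomial.basisMonomials k).constr k fun n : ℕ =>
    ∑ i ∈ Finset.Icc 1 n, (X ^ (n - i) : k[X]) ⊗ₜ[k] (X ^ (i - 1) : k[X])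

variable (lam : kˣ) (eta : k) (phi : k[X])

/-- The generalized Weyl algebra `A = k[z; λ, η, φ(z)]`. -/
abbrev Alg : Type u := GWA (sigma lam eta) phi

/-- The map `k[z] → A`. -/
noncomputable abbrev inc : k[X] →ₐ[k] Alg lam eta phi := GWA.ofBase (sigma lam eta) phi

/-- `^fΔ^g = (ι ⊗ ι) ∘ (f ⊗ g) ∘ Δ₀` with values in `A ⊗ A = Aᵉ`. -/
noncomputable def delta (f g : k[X] →ₗ[k] k[X]) : k[X] →ₗ[k] Env k (Alg lam eta phi) :=
  TensorProduct.map (inc lam eta phi).toLinearMap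
      ((MulOpposite.opLinearEquiv k).toLinearMap ∘ₗ (inc lam eta phi).toLinearMap) ∘ₗ
    TensorProduct.map f g ∘ₗ delta₀

/-- The element `x` of `A`. -/
noncomputable def gx : Alg lam eta phi := GWA.x (sigma lam eta) phi

/-- The element `y` of `A`. -/
noncomputable def gy : Alg lam eta phi := GWA.y (sigma lam eta) phi

/-- The element `z` of `A`. -/
noncomputable def gz : Alg lam eta phi := inc lam eta phi X

/-- The element `σ(z)` of `A`. -/
noncomputable def gσz : Alg lam eta phi := inc lam eta phi (sigma lam eta X)

/-- The element `σ⁻¹(z)` of `A`. -/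
noncomputable def gσz' : Alg lam eta phi := inc lam eta phi ((sigma lam eta).symm X)

/-- `σ` as a linear map. -/
noncomputable abbrev sigmaL : k[X] →ₗ[k] k[X] := (sigma lam eta).toLinearMap

/-- The rank of the free module `P (p, q)`: `1` for `p = 0` and `2` for `p ≥ 1` if `q ∈ {0, 1}`;
all other terms vanish. -/
def rk (a : ℤ × ℤ) : ℕ :=
  if a.2 = 0 ∨ a.2 = 1 then (if a.1 < 0 then 0 else if a.1 = 0 then 1 else 2) else 0

theorem rk_le (a : ℤ × ℤ) : rk a ≤ 2 := by
  unfold rk; split_ifs <;> omega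

/-- `P (p, q)` is the free left `Aᵉ`-module `(A ⊗ A)^{rk (p, q)}`. -/
abbrev P (a : ℤ × ℤ) : Type u := Fin (rk a) → Env k (Alg lam eta phi)

/-- The `Aᵉ`-linear map `P a → P b` sending the `i`-th generator to the `i`-th row of `M`. When a
rank is less than `2`, the superfluous rows or columns of `M` are not used. -/
noncomputable def rowMap (a b : ℤ × ℤ) (M : Matrix (Fin 2) (Fin 2) (Env k (Alg lam eta phi))) :
    P lam eta phi a →ₗ[Env k (Alg lam eta phi)] P lam eta phi b :=
  Matrix.toLinearMapRight' (M.submatrix (Fin.castLE (rk_le a)) (Fin.castLE (rk_le b)))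

/-- The rows are the images of the generators under `d^v_p : P (p, 1) → P (p, 0)`. -/
noncomputable def dvMat (p : ℤ) : Matrix (Fin 2) (Fin 2) (Env k (Alg lam eta phi)) :=
  let z := gz lam eta phi
  if p = 0 then
    !![bt k z 1 - bt k 1 z, 0;
       0, 0]
  else if Odd p then
    !![bt k (gσz lam eta phi) 1 - bt k 1 z, 0;
       0, bt k (gσz' lam eta phi) 1 - bt k 1 z]
  else
    !![bt k z 1 - bt k 1 z, 0;
       0, bt k z 1 - bt k 1 z]

/-- The rows are the images of the generators under `d^h_{p0} : P (p, 0) → P (p - 1, 0)`. -/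
noncomputable def dhMat₀ (p : ℤ) : Matrix (Fin 2) (Fin 2) (Env k (Alg lam eta phi)) :=
  let x := gx lam eta phi
  let y := gy lam eta phi
  if p = 1 then
    !![bt k x 1 - bt k 1 x, 0;
       bt k y 1 - bt k 1 y, 0]
  else if Odd p then
    !![bt k x 1, -bt k 1 x;
       -bt k 1 y, bt k y 1]
  else
    !![bt k y 1, bt k 1 x;
       bt k 1 y, bt k x 1]

/-- The rows are the images of the generators under `d^h_{p1} : P (p, 1) → P (p - 1, 1)`. -/
noncomputable def dhMat₁ (p : ℤ) : Matrix (Fin 2) (Fin 2) (Env k (Alg lam eta phi)) :=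
  let x := gx lam eta phi
  let y := gy lam eta phi
  let l : k := lam
  if p = 1 then
    !![-bt k x 1 + l • bt k 1 x, 0;
       -bt k y 1 + l⁻¹ • bt k 1 y, 0]
  else if Odd p then
    !![-bt k x 1, l • bt k 1 x;
       l⁻¹ • bt k 1 y, -bt k y 1]
  else
    !![-bt k y 1, -(l • bt k 1 x);
       -(l⁻¹ • bt k 1 y), -bt k x 1]

/-- The rows are the images of the generators under `r_p : P (p, 0) → P (p - 2, 1)`. -/
noncomputable def rMat (p : ℤ) : Matrix (Fin 2) (Fin 2) (Env k (Alg lam eta phi)) :=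
  let s := sigmaL lam eta
  let l : k := lam
  if p = 2 then
    !![-delta lam eta phi .id .id phi, 0;
       -(l • delta lam eta phi s s phi), 0]
  else if Odd p then
    !![-delta lam eta phi s .id phi, 0;
       0, -(l • delta lam eta phi .id s phi)]
  else
    !![-delta lam eta phi .id .id phi, 0;
       0, -(l • delta lam eta phi s s phi)]

/-- The two-row data `(P, d^v, d^h, r)` over `Aᵉ`. -/
noncomputable def doubleData :
    HomotopyDoubleData (ModuleCat.{u} (Env k (Alg lam eta phi))) where
  X a := ModuleCat.of _ (P lam eta phi a)
  dv a b := if b = (a.1, a.2 - 1) then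
    ModuleCat.ofHom (rowMap lam eta phi a b (dvMat lam eta phi a.1)) else 0
  dh a b := if b = (a.1 - 1, a.2) then
    ModuleCat.ofHom (rowMap lam eta phi a b
      (if a.2 = 0 then dhMat₀ lam eta phi a.1 else dhMat₁ lam eta phi a.1)) else 0
  r a b := if b = (a.1 - 2, a.2 + 1) then
    ModuleCat.ofHom (rowMap lam eta phi a b (rMat lam eta phi a.1)) else 0
  dv_shape _ _ h := if_neg h
  dh_shape _ _ h := if_neg h
  r_shape _ _ h := if_neg h

/-- The algebra `A` as an object of the category of left `Aᵉ`-modules. -/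
noncomputable def algObj : ModuleCat.{u} (Env k (Alg lam eta phi)) :=
  ModuleCat.of _ (Alg lam eta phi)

/-- The multiplication map `P (0, 0) = A ⊗ A → A`, `u ⊗ v ↦ u v`. -/
noncomputable def multMap : (doubleData lam eta phi).X (0, 0) ⟶ algObj lam eta phi :=
  ModuleCat.ofHom (Fintype.linearCombination (Env k (Alg lam eta phi))
    (fun _ : Fin (rk (0, 0)) => (1 : Alg lam eta phi)))

end PolyGWA

/-! Only the rows `q = 0, 1` are nonzero, so `Tot_n = P (n, 0) ⊕ P (n - 1, 1)`. On each generator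
`d^v` is right multiplication by some `τ(z) ⊗ 1 - 1 ⊗ z` with `τ` one of `id`, `σ`, `σ⁻¹`, and this
is injective. A diagram chase then reduces exactness of `Tot` to exactness of the row `q = 0` modulo
the image of `d^v`.

The algebraic input is that `A` is free as a left `k[z]`-module on `v j`, where `v j = x ^ j` for `j
≥ 0` and `v j = y ^ (-j)` for `j ≤ 0`; independence is seen on an explicit representation. Hence `A
⊗ A` modulo the left ideal generated by `τ(z) ⊗ 1 - 1 ⊗ z` is a twisted form of `A ⊗_{k[z]} A`, and
it is free over the left factor `A` on the classes of `1 ⊗ v j` (`coeffs_sec`, `coeffs_eq_zero`,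
`sub_sec_coeffs_mem`). In these coordinates `1 ⊗ x` shifts the index up on `j ≥ 0` and `1 ⊗ y`
shifts it down on `j ≤ 0`, without extra factors.

For `p ≥ 1`, subtracting images of `d^h` and `d^v` brings an element of `P (p, 0)` to a normal form
`(f, g)` with `f` supported in `j ≥ 0` and `g` in `j ≤ 0` (`exists_normal_form`). If `d^h` maps such
a pair into the image of `d^v`, then it is zero (`normal_form_eq_zero`): for `p ≥ 2` the two
contributions to each component have disjoint supports, and for `p = 1` the coefficients satisfy a
recursion incompatible with finite support. At `p = 0` the kernel of multiplication is the left
ideal generated by the `c ⊗ 1 - 1 ⊗ c` with `c = x, y, z`.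

The identities of a homotopy double complex rest on `Δ₀(p) (z ⊗ 1 - 1 ⊗ z) = p ⊗ 1 - 1 ⊗ p`. The
composite `d^h d^h` leaves differences of `φ` or `σ(φ)` in the two tensor factors, and `r`, built
from twists of `Δ(φ)`, divides these differences by the entries of `d^v`. -/

namespace GWA

/-! ### A basis of a generalized Weyl algebra over its base ring -/

section
variable {k : Type u} [CommRing k] {B : Type u} [CommRing B] [Algebra k B]
variable (σ : B ≃ₐ[k] B) (a : B)

theorem ofBase_apply (b : B) : ofBase σ a b = mk σ a (FreeAlgebra.ι k (.base b)) := rfl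

theorem x_mul_ofBase (b : B) : x σ a * ofBase σ a b = ofBase σ a (σ b) * x σ a := by
  have h := mk_rel σ a (.x_base b)
  simp only [map_mul] at h
  exact h

theorem y_mul_ofBase (b : B) : y σ a * ofBase σ a b = ofBase σ a (σ.symm b) * y σ a := by
  have h := mk_rel σ a (.y_base b)
  simp only [map_mul] at h
  exact h

theorem y_mul_x : y σ a * x σ a = ofBase σ a a := by
  have h := mk_rel σ a .y_x
  simp only [map_mul] at h
  exact h

theorem x_mul_y : x σ a * y σ a = ofBase σ a (σ a) := by
  have h := mk_rel σ a .x_y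
  simp only [map_mul] at h
  exact h

variable {σ a} in
/-- A subalgebra of a generalized Weyl algebra containing the generators is everything. -/
theorem mem_of_generators (S : Subalgebra k (GWA σ a)) (hb : ∀ b, ofBase σ a b ∈ S)
    (hx : x σ a ∈ S) (hy : y σ a ∈ S) (c : GWA σ a) : c ∈ S := by
  obtain ⟨w, rfl⟩ : ∃ w, mk σ a w = c := RingQuot.mkAlgHom_surjective k (Rel σ a) c
  induction w with
  | grade0 r => rw [AlgHom.commutes]; exact S.algebraMap_mem r
  | grade1 g =>
    cases g with
    | base b => exact hb b
    | x => exact hx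
    | y => exact hy
  | mul u v hu hv => rw [map_mul]; exact S.mul_mem hu hv
  | add u v hu hv => rw [map_add]; exact S.add_mem hu hv

/-- Left multiplication by `x` in the coordinates `b • v j`. -/
noncomputable def xEnd : (ℤ →₀ B) →ₗ[k] (ℤ →₀ B) :=
  Finsupp.lsum k fun j =>
    Finsupp.lsingle (j + 1) ∘ₗ LinearMap.mulLeft k (if 0 ≤ j then 1 else σ a) ∘ₗ σ.toLinearMap

/-- Left multiplication by `y` in the coordinates `b • v j`. -/
noncomputable def yEnd : (ℤ →₀ B) →ₗ[k] (ℤ →₀ B) :=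
  Finsupp.lsum k fun j =>
    Finsupp.lsingle (j - 1) ∘ₗ LinearMap.mulLeft k (if j ≤ 0 then 1 else a) ∘ₗ σ.symm.toLinearMap

@[simp] theorem xEnd_single (j : ℤ) (b : B) : xEnd σ a (Finsupp.single j b) =
    Finsupp.single (j + 1) ((if 0 ≤ j then 1 else σ a) * σ b) := by
  simp [xEnd]

@[simp] theorem yEnd_single (j : ℤ) (b : B) : yEnd σ a (Finsupp.single j b) =
    Finsupp.single (j - 1) ((if j ≤ 0 then 1 else a) * σ.symm b) := by
  simp [yEnd]

/-- The images of the generators in the regular representation. -/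
noncomputable def genEnd : GWAGen B → Module.End k (ℤ →₀ B)
  | .base b => Algebra.lsmul k k (ℤ →₀ B) b
  | .x => xEnd σ a
  | .y => yEnd σ a

/-- The weights of `xEnd` and `yEnd` are placed so that a step away from index `0` is free and a
step towards it costs `σ a` or `a`. In `y x` and `x y` exactly one of the two steps goes towards
`0`, so the factor appears once. -/
theorem genEnd_rel {s t : FreeAlgebra k (GWAGen B)} (h : Rel σ a s t) :
    FreeAlgebra.lift k (genEnd σ a) s = FreeAlgebra.lift k (genEnd σ a) t := by
  cases h with
  | add b c => simp [genEnd]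
  | mul b c => simp [genEnd]
  | algebraMap t => simp [genEnd]
  | one => simp [genEnd]
  | x_base b =>
    refine Finsupp.lhom_ext fun j c => ?_
    simp [genEnd, mul_left_comm, -Finsupp.single_mul]
  | y_base b =>
    refine Finsupp.lhom_ext fun j c => ?_
    simp [genEnd, mul_left_comm, -Finsupp.single_mul]
  | y_x =>
    refine Finsupp.lhom_ext fun j c => ?_
    rcases le_or_gt 0 j with h | h
    · simp [genEnd, h, show ¬ j + 1 ≤ 0 by omega]
    · simp [genEnd, show ¬ 0 ≤ j by omega, show j + 1 ≤ 0 by omega, -Finsupp.single_mul]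
  | x_y =>
    refine Finsupp.lhom_ext fun j c => ?_
    rcases le_or_gt j 0 with h | h
    · simp [genEnd, h, show ¬ 1 ≤ j by omega]
    · simp [genEnd, show ¬ j ≤ 0 by omega, show 1 ≤ j by omega, -Finsupp.single_mul]

/-- The regular representation of `B(σ, a)`, in the coordinates `b • v j`. -/
noncomputable def rep : GWA σ a →ₐ[k] Module.End k (ℤ →₀ B) :=
  RingQuot.liftAlgHom k ⟨FreeAlgebra.lift k (genEnd σ a), fun _ _ h => genEnd_rel σ a h⟩

theorem rep_mk (w : FreeAlgebra k (GWAGen B)) :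
    rep σ a (mk σ a w) = FreeAlgebra.lift k (genEnd σ a) w :=
  RingQuot.liftAlgHom_mkAlgHom_apply ..

@[simp] theorem rep_ofBase (b : B) (m : ℤ →₀ B) : rep σ a (ofBase σ a b) m = b • m := by
  simp [ofBase_apply, rep_mk, genEnd]

@[simp] theorem rep_x : rep σ a (x σ a) = xEnd σ a := by
  simp [x, rep_mk, genEnd]

@[simp] theorem rep_y : rep σ a (y σ a) = yEnd σ a := by
  simp [y, rep_mk, genEnd]

/-- The basis elements `x ^ j` and `y ^ (-j)` of `B(σ, a)` over `B`. -/
noncomputable def v (j : ℤ) : GWA σ a :=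
  if 0 ≤ j then x σ a ^ j.toNat else y σ a ^ (-j).toNat

theorem v_natCast (n : ℕ) : v σ a n = x σ a ^ n := by simp [v]

theorem v_neg_natCast (n : ℕ) : v σ a (-n) = y σ a ^ n := by
  rcases n.eq_zero_or_pos with rfl | h
  · simp [v]
  · simp [v, h.ne']

@[simp] theorem v_zero : v σ a 0 = 1 := by simp [v]

theorem x_mul_v {j : ℤ} (hj : 0 ≤ j) : x σ a * v σ a j = v σ a (j + 1) := by
  lift j to ℕ using hj
  rw [v_natCast, ← pow_succ', ← v_natCast, Nat.cast_succ]

theorem y_mul_v {j : ℤ} (hj : j ≤ 0) : y σ a * v σ a j = v σ a (j - 1) := by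
  obtain ⟨n, rfl⟩ : ∃ n : ℕ, j = -n := ⟨(-j).toNat, by omega⟩
  rw [v_neg_natCast, ← pow_succ', ← v_neg_natCast]
  congr 1; push_cast; ring

theorem x_mul_v' (j : ℤ) : x σ a * v σ a j =
    ofBase σ a (if 0 ≤ j then 1 else σ a) * v σ a (j + 1) := by
  split_ifs with h
  · rw [x_mul_v σ a h, map_one, one_mul]
  · rw [← x_mul_y, mul_assoc, y_mul_v σ a (by omega), add_sub_cancel_right]

theorem y_mul_v' (j : ℤ) : y σ a * v σ a j =
    ofBase σ a (if j ≤ 0 then 1 else a) * v σ a (j - 1) := by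
  split_ifs with h
  · rw [y_mul_v σ a h, map_one, one_mul]
  · rw [← y_mul_x, mul_assoc, x_mul_v σ a (by omega), sub_add_cancel]

/-- The linear map with `b • v j ↦ b * v j`. -/
noncomputable def ofCoord : (ℤ →₀ B) →ₗ[k] GWA σ a :=
  Finsupp.lsum k fun j => LinearMap.mulRight k (v σ a j) ∘ₗ (ofBase σ a).toLinearMap

@[simp] theorem ofCoord_single (j : ℤ) (b : B) :
    ofCoord σ a (Finsupp.single j b) = ofBase σ a b * v σ a j := by
  simp [ofCoord]

/-- The condition on `c` cuts out a subalgebra, so it suffices to test generators. Evaluated at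
`e_0`, this is the spanning half of the basis statement. -/
theorem ofCoord_rep (c : GWA σ a) (m : ℤ →₀ B) :
    ofCoord σ a (rep σ a c m) = c * ofCoord σ a m := by
  let S : Subalgebra k (GWA σ a) :=
    { carrier := {c | ∀ m, ofCoord σ a (rep σ a c m) = c * ofCoord σ a m}
      mul_mem' := fun {c d} hc hd m => by
        rw [map_mul, Module.End.mul_apply, hc, hd, mul_assoc]
      add_mem' := fun {c d} hc hd m => by
        rw [map_add, LinearMap.add_apply, map_add, hc, hd, add_mul]
      algebraMap_mem' := fun r m => by
        rw [AlgHom.commutes, Module.algebraMap_end_apply, map_smul, Algebra.smul_def] }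
  refine mem_of_generators S (fun b => ?_) ?_ ?_ c m <;> intro m <;>
    induction m using Finsupp.induction_linear with
    | zero => simp only [map_zero, mul_zero]
    | add f g hf hg => simp only [map_add, mul_add, hf, hg]
    | single j d => ?_
  · simp [mul_assoc, -Finsupp.single_mul]
  · rw [rep_x, xEnd_single, ofCoord_single, ofCoord_single, ← mul_assoc, x_mul_ofBase, mul_assoc,
      x_mul_v', ← mul_assoc, map_mul, ← map_mul, mul_comm, map_mul]
  · rw [rep_y, yEnd_single, ofCoord_single, ofCoord_single, ← mul_assoc, y_mul_ofBase, mul_assoc,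
      y_mul_v', ← mul_assoc, map_mul, ← map_mul, mul_comm, map_mul]

/-- The independence half of the basis statement: starting from `e_0`, powers of `x` or of `y`
always move away from index `0`, so no weight is picked up. -/
theorem rep_v (j : ℤ) : rep σ a (v σ a j) (Finsupp.single 0 1) = Finsupp.single j 1 := by
  obtain ⟨n, rfl | rfl⟩ := j.eq_nat_or_neg
  · induction n with
    | zero => simp
    | succ n ih =>
      rw [Nat.cast_succ, ← x_mul_v σ a (by omega), map_mul, Module.End.mul_apply, ih]
      simp
  · induction n with
    | zero => simp
    | succ n ih =>
      rw [Nat.cast_succ, neg_add', ← y_mul_v σ a (by omega), map_mul, Module.End.mul_apply, ih]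
      simp

/-- `B(σ, a)` is a free left `B`-module with basis `v j`, `j ∈ ℤ`. -/
noncomputable def coord : GWA σ a ≃ₗ[k] (ℤ →₀ B) where
  toFun c := rep σ a c (Finsupp.single 0 1)
  invFun := ofCoord σ a
  map_add' c d := by simp
  map_smul' t c := by simp
  left_inv c := by simp [ofCoord_rep]
  right_inv m := by
    induction m using Finsupp.induction_linear with
    | zero => simp
    | add f g hf hg => simp only [map_add, LinearMap.add_apply, hf, hg]
    | single j b => simp [rep_v]

theorem coord_ofBase_mul (b : B) (c : GWA σ a) :
    coord σ a (ofBase σ a b * c) = b • coord σ a c := by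
  simp [coord]

theorem coord_v (j : ℤ) : coord σ a (v σ a j) = Finsupp.single j 1 := rep_v σ a j

theorem coord_symm_single (j : ℤ) (b : B) :
    (coord σ a).symm (Finsupp.single j b) = ofBase σ a b * v σ a j := ofCoord_single σ a j b

end

end GWA

/-! ### Arithmetic in the enveloping algebra -/

section

variable {k : Type u} [CommRing k] {A : Type u} [Ring A] [Algebra k A]

theorem bt_mul_bt (u v u' v' : A) : bt k u v * bt k u' v' = bt k (u * u') (v' * v) :=
  Algebra.TensorProduct.tmul_mul_tmul _ _ _ _

theorem bt_one_one : bt k (1 : A) 1 = 1 := rfl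

theorem bt_add_left (u u' v : A) : bt k (u + u') v = bt k u v + bt k u' v :=
  TensorProduct.add_tmul _ _ _

theorem bt_add_right (u v v' : A) : bt k u (v + v') = bt k u v + bt k u v' :=
  TensorProduct.tmul_add _ _ _

theorem bt_sub_left (u u' v : A) : bt k (u - u') v = bt k u v - bt k u' v :=
  TensorProduct.sub_tmul _ _ _

theorem bt_smul_left (t : k) (u v : A) : bt k (t • u) v = t • bt k u v :=
  TensorProduct.smul_tmul' _ _ _

theorem bt_smul_right (t : k) (u v : A) : bt k u (t • v) = t • bt k u v := by
  rw [bt, MulOpposite.op_smul, TensorProduct.tmul_smul]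
  rfl

end

/-! ### The divided difference `Δ₀` and the commutation rules in `Aᵉ` -/

namespace PolyGWA

variable {k : Type u} [Field k]

theorem delta₀_X_pow (n : ℕ) : delta₀ (X ^ n : k[X]) =
    ∑ i ∈ Finset.Icc 1 n, (X ^ (n - i) : k[X]) ⊗ₜ[k] (X ^ (i - 1) : k[X]) := by
  have h := (basisMonomials k).constr_basis k (fun n : ℕ =>
    ∑ i ∈ Finset.Icc 1 n, (X ^ (n - i) : k[X]) ⊗ₜ[k] (X ^ (i - 1) : k[X])) n
  rw [coe_basisMonomials] at h
  beta_reduce at h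
  rwa [monomial_one_right_eq_X_pow] at h

theorem delta₀_X_pow_succ (n : ℕ) : delta₀ (X ^ (n + 1) : k[X]) =
    (X ⊗ₜ[k] 1) * delta₀ (X ^ n) + 1 ⊗ₜ[k] (X ^ n) := by
  rw [delta₀_X_pow, delta₀_X_pow, Finset.sum_Icc_succ_top (by omega), Finset.mul_sum]
  congr 1
  · refine Finset.sum_congr rfl fun i hi => ?_
    rw [Finset.mem_Icc] at hi
    rw [Algebra.TensorProduct.tmul_mul_tmul, ← pow_succ', one_mul]
    congr 2
    omega
  · simp

/-- The sum defining `Δ₀(z ^ n)` telescopes, so `Δ₀` is the divided difference of a polynomial. This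
is the only property of `Δ₀` used in the rest of the argument. -/
theorem delta₀_mul_sub (p : k[X]) :
    delta₀ p * ((X : k[X]) ⊗ₜ[k] (1 : k[X]) - (1 : k[X]) ⊗ₜ[k] (X : k[X])) =
      p ⊗ₜ[k] (1 : k[X]) - (1 : k[X]) ⊗ₜ[k] p := by
  induction p using Polynomial.induction_on' with
  | add p q hp hq =>
    rw [map_add, add_mul, hp, hq, TensorProduct.add_tmul, TensorProduct.tmul_add]
    abel
  | monomial n c =>
    rw [← C_mul_X_pow_eq_monomial, ← smul_eq_C_mul, map_smul, smul_mul_assoc,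
      TensorProduct.tmul_smul, ← TensorProduct.smul_tmul']
    refine Eq.trans (congrArg (c • ·) ?_) 
      (smul_sub c ((X ^ n : k[X]) ⊗ₜ[k] (1 : k[X])) ((1 : k[X]) ⊗ₜ[k] (X ^ n : k[X])))
    induction n with
    | zero =>
      rw [delta₀_X_pow]
      simp
    | succ n ih =>
      rw [delta₀_X_pow_succ, add_mul, mul_assoc, ih, mul_sub, mul_sub]
      simp only [Algebra.TensorProduct.tmul_mul_tmul, ← pow_succ', ← pow_succ, one_mul, mul_one]
      abel

variable (lam : kˣ) (eta : k) (phi : k[X])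

/-- The homomorphism `k[z] ⊗ k[z] → A ⊗ Aᵒᵖ`. -/
noncomputable def polyEnv : k[X] ⊗[k] k[X] →ₐ[k] Env k (Alg lam eta phi) :=
  Algebra.TensorProduct.map (inc lam eta phi)
    ((inc lam eta phi).toOpposite fun p q => by
      rw [commute_iff_eq, ← map_mul, mul_comm, map_mul])

theorem polyEnv_tmul (p q : k[X]) :
    polyEnv lam eta phi (p ⊗ₜ q) = bt k (inc lam eta phi p) (inc lam eta phi q) := rfl

theorem delta_eq_polyEnv (f g : k[X] →ₗ[k] k[X]) (p : k[X]) :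
    delta lam eta phi f g p = polyEnv lam eta phi (TensorProduct.map f g (delta₀ p)) := rfl

/-- Since `f` and `g` are algebra maps, `f ⊗ g` transports the divided difference identity. It
serves both for the identities involving `r` and for moving polynomials across the tensor sign
modulo `balIdeal`. -/
theorem delta_mul_sub (f g : k[X] →ₐ[k] k[X]) (p : k[X]) :
    delta lam eta phi f.toLinearMap g.toLinearMap p *
        (bt k (inc lam eta phi (f X)) 1 - bt k 1 (inc lam eta phi (g X))) =
      bt k (inc lam eta phi (f p)) 1 - bt k 1 (inc lam eta phi (g p)) := by
  have h := congrArg (fun t => polyEnv lam eta phi (Algebra.TensorProduct.map f g t))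
    (delta₀_mul_sub p)
  simp only [map_mul, map_sub, Algebra.TensorProduct.map_tmul, map_one, polyEnv_tmul] at h
  exact h

local notation "xL" => bt k (gx lam eta phi) 1
local notation "xR" => bt k 1 (gx lam eta phi)
local notation "yL" => bt k (gy lam eta phi) 1
local notation "yR" => bt k 1 (gy lam eta phi)
local notation "zL" => bt k (gz lam eta phi) 1
local notation "zR" => bt k 1 (gz lam eta phi)

section commutation

theorem polyEnv_comm (s t : k[X] ⊗[k] k[X]) : polyEnv lam eta phi s * polyEnv lam eta phi t =
    polyEnv lam eta phi t * polyEnv lam eta phi s := by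
  rw [← map_mul, mul_comm, map_mul]

theorem gx_mul_inc (p : k[X]) : gx lam eta phi * inc lam eta phi p =
    inc lam eta phi (sigma lam eta p) * gx lam eta phi := GWA.x_mul_ofBase _ _ _

theorem gy_mul_inc (p : k[X]) : gy lam eta phi * inc lam eta phi p =
    inc lam eta phi ((sigma lam eta).symm p) * gy lam eta phi := GWA.y_mul_ofBase _ _ _

theorem gy_mul_inc_sigma (p : k[X]) : gy lam eta phi * inc lam eta phi (sigma lam eta p) =
    inc lam eta phi p * gy lam eta phi := by
  rw [gy_mul_inc, AlgEquiv.symm_apply_apply]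

theorem xL_mul_polyEnv (t : k[X] ⊗[k] k[X]) : xL * polyEnv lam eta phi t =
    polyEnv lam eta phi (TensorProduct.map (sigmaL lam eta) .id t) * xL := by
  induction t with
  | zero => simp only [map_zero, mul_zero, zero_mul]
  | add s t hs ht => simp only [map_add, mul_add, add_mul, hs, ht]
  | tmul p q =>
    rw [TensorProduct.map_tmul, polyEnv_tmul, polyEnv_tmul, bt_mul_bt, bt_mul_bt, gx_mul_inc,
      one_mul, mul_one]
    rfl

theorem yL_mul_polyEnv (t : k[X] ⊗[k] k[X]) :
    yL * polyEnv lam eta phi (TensorProduct.map (sigmaL lam eta) .id t) =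
    polyEnv lam eta phi t * yL := by
  induction t with
  | zero => simp only [map_zero, mul_zero, zero_mul]
  | add s t hs ht => simp only [map_add, mul_add, add_mul, hs, ht]
  | tmul p q =>
    rw [TensorProduct.map_tmul, polyEnv_tmul, polyEnv_tmul, bt_mul_bt, bt_mul_bt,
      one_mul, mul_one, ← gy_mul_inc_sigma]
    rfl

/-- The second factor carries the opposite multiplication, so there the roles are exchanged: passing
`1 ⊗ x` to the right removes a `σ`, and passing `1 ⊗ y` inserts one. -/
theorem xR_mul_polyEnv (t : k[X] ⊗[k] k[X]) :
    xR * polyEnv lam eta phi (TensorProduct.map .id (sigmaL lam eta) t) =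
    polyEnv lam eta phi t * xR := by
  induction t with
  | zero => simp only [map_zero, mul_zero, zero_mul]
  | add s t hs ht => simp only [map_add, mul_add, add_mul, hs, ht]
  | tmul p q =>
    rw [TensorProduct.map_tmul, polyEnv_tmul, polyEnv_tmul, bt_mul_bt, bt_mul_bt, gx_mul_inc,
      one_mul, mul_one]
    rfl

theorem yR_mul_polyEnv (t : k[X] ⊗[k] k[X]) : yR * polyEnv lam eta phi t =
    polyEnv lam eta phi (TensorProduct.map .id (sigmaL lam eta) t) * yR := by
  induction t with
  | zero => simp only [map_zero, mul_zero, zero_mul]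
  | add s t hs ht => simp only [map_add, mul_add, add_mul, hs, ht]
  | tmul p q =>
    rw [TensorProduct.map_tmul, polyEnv_tmul, polyEnv_tmul, bt_mul_bt, bt_mul_bt,
      one_mul, mul_one, ← gy_mul_inc_sigma]
    rfl

theorem inc_sigma_X : inc lam eta phi (sigma lam eta X) =
    (lam : k) • gz lam eta phi + eta • 1 := by
  rw [sigma_X, ← smul_eq_C_mul, map_add, map_smul, ← mul_one (C eta), ← smul_eq_C_mul, map_smul,
    map_one]
  rfl

theorem sigma_symm_X : (sigma lam eta).symm X = (lam : k)⁻¹ • (X - C eta) := by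
  rw [AlgEquiv.symm_apply_eq, map_smul, map_sub, sigma_X, ← algebraMap_eq, AlgEquiv.commutes,
    add_sub_cancel_right, algebraMap_eq, ← smul_eq_C_mul, inv_smul_smul₀ lam.ne_zero]

theorem inc_sigma_symm_X : inc lam eta phi ((sigma lam eta).symm X) =
    (lam : k)⁻¹ • (gz lam eta phi - eta • 1) := by
  rw [sigma_symm_X, map_smul, map_sub, ← mul_one (C eta), ← smul_eq_C_mul, map_smul, map_one]
  rfl

theorem bt_gσz : bt k (gσz lam eta phi) 1 = (lam : k) • zL + eta • 1 := by
  rw [gσz, inc_sigma_X, bt_add_left, bt_smul_left, bt_smul_left, bt_one_one]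

theorem bt_gσz' : bt k (gσz' lam eta phi) 1 = (lam : k)⁻¹ • (zL - eta • 1) := by
  rw [gσz', inc_sigma_symm_X, bt_smul_left, bt_sub_left, bt_smul_left, bt_one_one]

/-- This and the following relations are oriented as rewriting rules: `z` moves to the left of `x`
and `y`, left-factor generators precede right-factor ones, and products of `x` with `y` in one
factor collapse to `φ` or `σ(φ)`. Every entry of the matrix identities thus becomes a
`k`-combination of normal words. -/
theorem zR_mul_zL : zR * zL = zL * zR := by simp only [bt_mul_bt, one_mul, mul_one]

theorem xL_mul_zL : xL * zL = (lam : k) • (zL * xL) + eta • xL := by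
  have h := congrArg (fun t => bt k t (1 : Alg lam eta phi)) (gx_mul_inc lam eta phi X)
  rw [inc_sigma_X, add_mul, smul_mul_assoc, smul_mul_assoc, one_mul, bt_add_left, bt_smul_left,
    bt_smul_left] at h
  rw [bt_mul_bt, bt_mul_bt, one_mul]
  exact h

theorem yL_mul_zL : yL * zL = (lam : k)⁻¹ • (zL * yL - eta • yL) := by
  have h := congrArg (fun t => bt k t (1 : Alg lam eta phi)) (gy_mul_inc lam eta phi X)
  rw [inc_sigma_symm_X, smul_mul_assoc, sub_mul, smul_mul_assoc, one_mul, bt_smul_left,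
    bt_sub_left, bt_smul_left] at h
  rw [bt_mul_bt, bt_mul_bt, one_mul]
  exact h

theorem xL_mul_zR : xL * zR = zR * xL := by simp only [bt_mul_bt, one_mul, mul_one]
theorem yL_mul_zR : yL * zR = zR * yL := by simp only [bt_mul_bt, one_mul, mul_one]
theorem xR_mul_zL : xR * zL = zL * xR := by simp only [bt_mul_bt, one_mul, mul_one]
theorem yR_mul_zL : yR * zL = zL * yR := by simp only [bt_mul_bt, one_mul, mul_one]
theorem xR_mul_xL : xR * xL = xL * xR := by simp only [bt_mul_bt, one_mul, mul_one]
theorem yR_mul_yL : yR * yL = yL * yR := by simp only [bt_mul_bt, one_mul, mul_one]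
theorem xR_mul_yL : xR * yL = yL * xR := by simp only [bt_mul_bt, one_mul, mul_one]
theorem yR_mul_xL : yR * xL = xL * yR := by simp only [bt_mul_bt, one_mul, mul_one]

theorem yR_mul_zR : yR * zR = (lam : k) • (zR * yR) + eta • yR := by
  have h := congrArg (fun t => bt k (1 : Alg lam eta phi) t) (gy_mul_inc_sigma lam eta phi X)
  rw [inc_sigma_X, mul_add, mul_smul_comm, mul_smul_comm, mul_one, bt_add_right, bt_smul_right,
    bt_smul_right] at h
  rw [bt_mul_bt, bt_mul_bt, one_mul]
  exact h.symm

theorem xR_mul_zR : xR * zR = (lam : k)⁻¹ • (zR * xR - eta • xR) := by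
  have h := congrArg (fun t => bt k (1 : Alg lam eta phi) t) (gx_mul_inc lam eta phi X)
  rw [inc_sigma_X, add_mul, smul_mul_assoc, smul_mul_assoc, one_mul, bt_add_right, bt_smul_right,
    bt_smul_right] at h
  rw [eq_inv_smul_iff₀ lam.ne_zero, eq_sub_iff_add_eq, bt_mul_bt, bt_mul_bt, one_mul]
  exact h.symm

theorem yL_mul_xL : yL * xL = bt k (inc lam eta phi phi) 1 := by
  rw [bt_mul_bt, one_mul]
  exact congrArg (fun t => bt k t 1) (GWA.y_mul_x _ _)

theorem xL_mul_yL : xL * yL = bt k (inc lam eta phi (sigma lam eta phi)) 1 := by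
  rw [bt_mul_bt, one_mul]
  exact congrArg (fun t => bt k t 1) (GWA.x_mul_y _ _)

theorem xR_mul_yR : xR * yR = bt k 1 (inc lam eta phi phi) := by
  rw [bt_mul_bt, one_mul]
  exact congrArg (fun t => bt k 1 t) (GWA.y_mul_x _ _)

theorem yR_mul_xR : yR * xR = bt k 1 (inc lam eta phi (sigma lam eta phi)) := by
  rw [bt_mul_bt, one_mul]
  exact congrArg (fun t => bt k 1 t) (GWA.x_mul_y _ _)

local notation "δ" => delta lam eta phi LinearMap.id LinearMap.id phi
local notation "δσ" => delta lam eta phi LinearMap.id (sigmaL lam eta) phi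
local notation "σδ" => delta lam eta phi (sigmaL lam eta) LinearMap.id phi
local notation "σδσ" => delta lam eta phi (sigmaL lam eta) (sigmaL lam eta) phi
local notation "φL" => bt k (inc lam eta phi phi) 1
local notation "φR" => bt k 1 (inc lam eta phi phi)
local notation "σφL" => bt k (inc lam eta phi (sigma lam eta phi)) 1
local notation "σφR" => bt k 1 (inc lam eta phi (sigma lam eta phi))

theorem zL_mul_delta (f g : k[X] →ₗ[k] k[X]) (p : k[X]) :
    zL * delta lam eta phi f g p = delta lam eta phi f g p * zL := by
  have h := polyEnv_comm lam eta phi (X ⊗ₜ 1) (TensorProduct.map f g (delta₀ p))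
  rwa [polyEnv_tmul, map_one] at h

theorem zR_mul_delta (f g : k[X] →ₗ[k] k[X]) (p : k[X]) :
    zR * delta lam eta phi f g p = delta lam eta phi f g p * zR := by
  have h := polyEnv_comm lam eta phi (1 ⊗ₜ X) (TensorProduct.map f g (delta₀ p))
  rwa [polyEnv_tmul, map_one] at h

/-- The divided difference identity solved for the term with `z ⊗ 1`, which makes it a rule
eliminating that factor next to `Δ(φ)`. The three twisted versions follow, with `σ(z) = λ z + η`
expanded. -/
theorem delta_mul_zL : δ * zL = δ * zR + φL - φR := by
  have h := delta_mul_sub lam eta phi (.id k _) (.id k _) phi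
  rw [mul_sub] at h
  rw [add_sub_assoc, ← sub_eq_iff_eq_add']
  exact h

theorem delta_sigma_mul_zL : δσ * zL = (lam : k) • (δσ * zR) + eta • δσ + φL - σφR := by
  have h := delta_mul_sub lam eta phi (.id k _) (sigma lam eta).toAlgHom phi
  rw [mul_sub] at h
  rw [add_sub_assoc, ← sub_eq_iff_eq_add']
  refine Eq.trans ?_ h
  change _ = δσ * _ - δσ * bt k 1 (inc lam eta phi (sigma lam eta X))
  rw [inc_sigma_X, bt_add_right, bt_smul_right, bt_smul_right, mul_add, mul_smul_comm,
    mul_smul_comm, bt_one_one, mul_one]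
  rfl

theorem sigma_delta_mul_zL :
    σδ * zL = (lam : k)⁻¹ • (σδ * zR - eta • σδ + σφL - φR) := by
  have h := delta_mul_sub lam eta phi (sigma lam eta).toAlgHom (.id k _) phi
  change σδ * (bt k (inc lam eta phi (sigma lam eta X)) 1 - zR) = σφL - φR at h
  rw [mul_sub, inc_sigma_X, bt_add_left, bt_smul_left, bt_smul_left, mul_add, mul_smul_comm,
    mul_smul_comm, bt_one_one, mul_one] at h
  rw [eq_inv_smul_iff₀ lam.ne_zero, add_sub_assoc, ← h]
  abel

theorem sigma_delta_sigma_mul_zL :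
    σδσ * zL = σδσ * zR + (lam : k)⁻¹ • (σφL - σφR) := by
  have h := delta_mul_sub lam eta phi (sigma lam eta).toAlgHom (sigma lam eta).toAlgHom phi
  change σδσ * (bt k (inc lam eta phi (sigma lam eta X)) 1 -
    bt k 1 (inc lam eta phi (sigma lam eta X))) = σφL - σφR at h
  rw [inc_sigma_X, bt_add_left, bt_smul_left, bt_smul_left, bt_add_right, bt_smul_right,
    bt_smul_right, add_sub_add_right_eq_sub, mul_sub, mul_smul_comm, mul_smul_comm] at h
  rw [← h]
  refine eq_add_of_sub_eq' (Eq.trans ?_ (congrArg _ (smul_sub (lam : k) _ _)))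
  exact (inv_smul_smul₀ lam.ne_zero _).symm

theorem xL_mul_delta (g : k[X] →ₗ[k] k[X]) (p : k[X]) : xL * delta lam eta phi .id g p =
    delta lam eta phi (sigmaL lam eta) g p * xL := by
  rw [delta_eq_polyEnv, delta_eq_polyEnv, xL_mul_polyEnv, ← LinearMap.comp_apply,
    ← TensorProduct.map_comp]
  rfl

theorem yL_mul_delta (g : k[X] →ₗ[k] k[X]) (p : k[X]) :
    yL * delta lam eta phi (sigmaL lam eta) g p = delta lam eta phi .id g p * yL := by
  rw [delta_eq_polyEnv, delta_eq_polyEnv, ← yL_mul_polyEnv,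
    ← LinearMap.comp_apply (TensorProduct.map (sigmaL lam eta) LinearMap.id),
    ← TensorProduct.map_comp]
  rfl

theorem xR_mul_delta (f : k[X] →ₗ[k] k[X]) (p : k[X]) :
    xR * delta lam eta phi f (sigmaL lam eta) p = delta lam eta phi f .id p * xR := by
  rw [delta_eq_polyEnv, delta_eq_polyEnv, ← xR_mul_polyEnv,
    ← LinearMap.comp_apply (TensorProduct.map LinearMap.id (sigmaL lam eta)),
    ← TensorProduct.map_comp]
  rfl

theorem yR_mul_delta (f : k[X] →ₗ[k] k[X]) (p : k[X]) : yR * delta lam eta phi f .id p =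
    delta lam eta phi f (sigmaL lam eta) p * yR := by
  rw [delta_eq_polyEnv, delta_eq_polyEnv, yR_mul_polyEnv, ← LinearMap.comp_apply,
    ← TensorProduct.map_comp]
  rfl

end commutation

end PolyGWA

section

variable {k : Type u} [CommRing k] {A : Type u} [Ring A] [Algebra k A]

/-- Signs are turned into scalars so that the rules for pulling scalars out of products treat them
as well. -/
theorem env_neg (w : Env k A) : -w = (-1 : k) • w := (neg_one_smul k w).symm

theorem env_sub (w w' : Env k A) : w - w' = w + (-1 : k) • w' := by
  rw [sub_eq_add_neg, ← env_neg]

end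

namespace PolyGWA

variable {k : Type u} [Field k] (lam : kˣ) (eta : k) (phi : k[X])

/-! ### The identities of the homotopy double complex as matrix identities -/

section equations

set_option linter.unusedSimpArgs false

/-- The equation `dh dv + dv dh = 0` in matrix form. -/
theorem dvMat_mul_dhMat (p : ℤ) (hp : 1 ≤ p) :
    dvMat lam eta phi p * dhMat₀ lam eta phi p + dhMat₁ lam eta phi p * dvMat lam eta phi (p - 1) =
      0 := by
  have hl := lam.ne_zero
  unfold dvMat dhMat₀ dhMat₁
  have h0 : ¬ p = 0 := by omega
  have h2 : p - 1 = 0 ↔ p = 1 := by omega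
  have h3 : Odd (p - 1) ↔ ¬ Odd p := by grind
  have h4 : p = 1 → Odd p := by grind
  -- `propComplete` gives `(p = 1) = True` or `(p = 1) = False`, which rewrites the conditions in
  -- the matrices while leaving `p` itself untouched.
  rcases Classical.propComplete (p = 1) with h1 | h1 <;> by_cases hodd : Odd p <;>
    try exact absurd (h4 (of_eq_true h1)) hodd
  all_goals
    simp only [*, not_true, not_false_eq_true, if_true, if_false, Matrix.mul_fin_two, bt_gσz,
      bt_gσz']
    ext i j
    fin_cases i <;> fin_cases j <;>
    simp only [Matrix.add_apply, Matrix.of_apply, Matrix.cons_val, Matrix.zero_apply,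
      Fin.zero_eta, Fin.mk_one, env_neg, env_sub, mul_add, add_mul, mul_smul_comm,
      smul_mul_assoc, one_mul, mul_one, mul_zero, zero_mul, smul_add, smul_zero, zR_mul_zL,
      xL_mul_zL, yL_mul_zL, xL_mul_zR, yL_mul_zR,
      xR_mul_zL, yR_mul_zL, xR_mul_zR, yR_mul_zR, xR_mul_xL, yR_mul_yL, xR_mul_yL, yR_mul_xL,
      yL_mul_xL, xL_mul_yL, xR_mul_yR, yR_mul_xR] <;>
    match_scalars <;> (try field_simp) <;> ring

/-- The equation `dh² + dv r + r dv = 0` in the row `q = 0` in matrix form. -/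
theorem dhMat₀_mul_dhMat₀ (p : ℤ) (hp : 2 ≤ p) :
    dhMat₀ lam eta phi p * dhMat₀ lam eta phi (p - 1) +
      rMat lam eta phi p * dvMat lam eta phi (p - 2) = 0 := by
  have hl := lam.ne_zero
  unfold dvMat dhMat₀ rMat
  have h0 : ¬ p = 0 := by omega
  have h1 : ¬ p = 1 := by omega
  have h2 : p - 1 = 1 ↔ p = 2 := by omega
  have h3 : p - 2 = 0 ↔ p = 2 := by omega
  have h4 : Odd (p - 1) ↔ ¬ Odd p := by grind
  have h5 : Odd (p - 2) ↔ Odd p := by grind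
  have h6 : p = 2 → ¬ Odd p := by grind
  rcases Classical.propComplete (p = 2) with h7 | h7 <;> by_cases hodd : Odd p <;>
    try exact absurd hodd (h6 (of_eq_true h7))
  all_goals
    simp only [*, not_true, not_false_eq_true, if_true, if_false, Matrix.mul_fin_two, bt_gσz,
      bt_gσz']
    ext i j
    fin_cases i <;> fin_cases j <;>
    simp only [Matrix.add_apply, Matrix.of_apply, Matrix.cons_val, Matrix.zero_apply,
      Fin.zero_eta, Fin.mk_one, env_neg, env_sub, mul_add, add_mul, mul_smul_comm,
      smul_mul_assoc, one_mul, mul_one, mul_zero, zero_mul, smul_add, smul_zero, zR_mul_zL,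
      xL_mul_zL, yL_mul_zL, xL_mul_zR, yL_mul_zR,
      xR_mul_zL, yR_mul_zL, xR_mul_zR, yR_mul_zR, xR_mul_xL, yR_mul_yL, xR_mul_yL, yR_mul_xL,
      yL_mul_xL, xL_mul_yL, xR_mul_yR, yR_mul_xR, zL_mul_delta, zR_mul_delta, xL_mul_delta,
      yL_mul_delta, xR_mul_delta, yR_mul_delta, delta_mul_zL, delta_sigma_mul_zL,
      sigma_delta_mul_zL, sigma_delta_sigma_mul_zL] <;>
    match_scalars <;> (try field_simp) <;> ring

/-- The equation `dh² + dv r + r dv = 0` in the row `q = 1` in matrix form. -/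
theorem dhMat₁_mul_dhMat₁ (p : ℤ) (hp : 2 ≤ p) :
    dhMat₁ lam eta phi p * dhMat₁ lam eta phi (p - 1) +
      dvMat lam eta phi p * rMat lam eta phi p = 0 := by
  have hl := lam.ne_zero
  unfold dvMat dhMat₁ rMat
  have h0 : ¬ p = 0 := by omega
  have h1 : ¬ p = 1 := by omega
  have h2 : p - 1 = 1 ↔ p = 2 := by omega
  have h3 : p - 2 = 0 ↔ p = 2 := by omega
  have h4 : Odd (p - 1) ↔ ¬ Odd p := by grind
  have h5 : Odd (p - 2) ↔ Odd p := by grind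
  have h6 : p = 2 → ¬ Odd p := by grind
  rcases Classical.propComplete (p = 2) with h7 | h7 <;> by_cases hodd : Odd p <;>
    try exact absurd hodd (h6 (of_eq_true h7))
  all_goals
    simp only [*, not_true, not_false_eq_true, if_true, if_false, Matrix.mul_fin_two, bt_gσz,
      bt_gσz']
    ext i j
    fin_cases i <;> fin_cases j <;>
    simp only [Matrix.add_apply, Matrix.of_apply, Matrix.cons_val, Matrix.zero_apply,
      Fin.zero_eta, Fin.mk_one, env_neg, env_sub, mul_add, add_mul, mul_smul_comm,
      smul_mul_assoc, one_mul, mul_one, mul_zero, zero_mul, smul_add, smul_zero, zR_mul_zL,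
      xL_mul_zL, yL_mul_zL, xL_mul_zR, yL_mul_zR,
      xR_mul_zL, yR_mul_zL, xR_mul_zR, yR_mul_zR, xR_mul_xL, yR_mul_yL, xR_mul_yL, yR_mul_xL,
      yL_mul_xL, xL_mul_yL, xR_mul_yR, yR_mul_xR, zL_mul_delta, zR_mul_delta, xL_mul_delta,
      yL_mul_delta, xR_mul_delta, yR_mul_delta, delta_mul_zL, delta_sigma_mul_zL,
      sigma_delta_mul_zL, sigma_delta_sigma_mul_zL] <;>
    match_scalars <;> (try field_simp) <;> ring

/-- The equation `dh r + r dh = 0` in matrix form. -/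
theorem rMat_mul_dhMat₁ (p : ℤ) (hp : 3 ≤ p) :
    rMat lam eta phi p * dhMat₁ lam eta phi (p - 2) +
      dhMat₀ lam eta phi p * rMat lam eta phi (p - 1) = 0 := by
  have hl := lam.ne_zero
  unfold dhMat₀ dhMat₁ rMat
  have h0 : ¬ p = 1 := by omega
  have h1 : ¬ p = 2 := by omega
  have h2 : p - 1 = 2 ↔ p = 3 := by omega
  have h3 : p - 2 = 1 ↔ p = 3 := by omega
  have h4 : Odd (p - 1) ↔ ¬ Odd p := by grind
  have h5 : Odd (p - 2) ↔ Odd p := by grind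
  have h6 : p = 3 → Odd p := by grind
  rcases Classical.propComplete (p = 3) with h7 | h7 <;> by_cases hodd : Odd p <;>
    try exact absurd (h6 (of_eq_true h7)) hodd
  all_goals
    simp only [*, not_true, not_false_eq_true, if_true, if_false, Matrix.mul_fin_two, bt_gσz,
      bt_gσz']
    ext i j
    fin_cases i <;> fin_cases j <;>
    simp only [Matrix.add_apply, Matrix.of_apply, Matrix.cons_val, Matrix.zero_apply,
      Fin.zero_eta, Fin.mk_one, env_neg, env_sub, mul_add, add_mul, mul_smul_comm,
      smul_mul_assoc, one_mul, mul_one, mul_zero, zero_mul, smul_add, smul_zero, zR_mul_zL,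
      xL_mul_zL, yL_mul_zL, xL_mul_zR, yL_mul_zR,
      xR_mul_zL, yR_mul_zL, xR_mul_zR, yR_mul_zR, xR_mul_xL, yR_mul_yL, xR_mul_yL, yR_mul_xL,
      yL_mul_xL, xL_mul_yL, xR_mul_yR, yR_mul_xR, zL_mul_delta, zR_mul_delta, xL_mul_delta,
      yL_mul_delta, xR_mul_delta, yR_mul_delta, delta_mul_zL, delta_sigma_mul_zL,
      sigma_delta_mul_zL, sigma_delta_sigma_mul_zL] <;>
    match_scalars <;> (try field_simp) <;> ring

end equations

end PolyGWA

namespace PolyGWA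

variable {k : Type u} [Field k] (lam : kˣ) (eta : k) (phi : k[X])

/-! ### From matrices to morphisms of the double complex -/

section rowMap

variable {lam eta phi}

/-- Extension by zero `P a → (A ⊗ A)²`. -/
noncomputable def ext (a : ℤ × ℤ) (w : P lam eta phi a) : Fin 2 → Env k (Alg lam eta phi) :=
  fun i => if h : i.1 < rk a then w ⟨i, h⟩ else 0

/-- The projection `(A ⊗ A)² → P a`. -/
def res (a : ℤ × ℤ) (w : Fin 2 → Env k (Alg lam eta phi)) : P lam eta phi a :=
  fun i => w (Fin.castLE (rk_le a) i)

theorem res_ext (a : ℤ × ℤ) (w : P lam eta phi a) : res a (ext a w) = w := by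
  funext i
  simp [res, ext]

theorem ext_res (a : ℤ × ℤ) (w : Fin 2 → Env k (Alg lam eta phi))
    (hw : ∀ j : Fin 2, rk a ≤ j.1 → w j = 0) : ext a (res a w) = w := by
  funext i
  by_cases h : i.1 < rk a
  · simp [res, ext, h]
  · simp [ext, h, hw i (not_lt.mp h)]

theorem rowMap_apply (a b : ℤ × ℤ) (M : Matrix (Fin 2) (Fin 2) (Env k (Alg lam eta phi)))
    (w : P lam eta phi a) :
    rowMap lam eta phi a b M w = res b (Matrix.vecMul (ext a w) M) := by
  funext j
  rw [rowMap, Matrix.toLinearMapRight'_apply]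
  simp only [res, Matrix.vecMul, dotProduct, Matrix.submatrix_apply]
  refine Finset.sum_of_injOn (Fin.castLE (rk_le a)) (Fin.castLE_injective _).injOn
    (fun _ _ => Finset.mem_coe.mpr (Finset.mem_univ _)) (fun i _ hi => ?_) (fun i _ => ?_)
  · have h : ¬ i.1 < rk a := fun h => hi ⟨⟨i, h⟩, Finset.mem_coe.mpr (Finset.mem_univ _), rfl⟩
    simp [ext, h]
  · simp [ext]

theorem rowMap_res (a b : ℤ × ℤ) (M : Matrix (Fin 2) (Fin 2) (Env k (Alg lam eta phi)))
    (w : Fin 2 → Env k (Alg lam eta phi)) (hw : ∀ j : Fin 2, rk a ≤ j.1 → w j = 0) :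
    rowMap lam eta phi a b M (res a w) = res b (Matrix.vecMul w M) := by
  rw [rowMap_apply, ext_res a w hw]

/-- The intermediate object keeps only the first `rk b` coordinates; `hM` says that the discarded
ones are zero, so nothing is lost. With generators as rows, composition is the matrix product in
diagrammatic order. -/
theorem rowMap_rowMap (a b c : ℤ × ℤ) (M N : Matrix (Fin 2) (Fin 2) (Env k (Alg lam eta phi)))
    (hM : ∀ i j : Fin 2, rk b ≤ j.1 → M i j = 0) (w : P lam eta phi a) :
    rowMap lam eta phi b c N (rowMap lam eta phi a b M w) = rowMap lam eta phi a c (M * N) w := by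
  rw [rowMap_apply a b, rowMap_res, Matrix.vecMul_vecMul, ← rowMap_apply]
  intro j hj
  simp [Matrix.vecMul, dotProduct, hM _ j hj]

theorem rowMap_add (a b : ℤ × ℤ) (M N : Matrix (Fin 2) (Fin 2) (Env k (Alg lam eta phi)))
    (w : P lam eta phi a) :
    rowMap lam eta phi a b (M + N) w =
      rowMap lam eta phi a b M w + rowMap lam eta phi a b N w := by
  simp only [rowMap_apply, Matrix.vecMul_add]
  rfl

theorem rowMap_zero (a b : ℤ × ℤ) (w : P lam eta phi a) :
    rowMap lam eta phi a b 0 w = 0 := by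
  rw [rowMap_apply, Matrix.vecMul_zero]
  rfl

theorem rowMap_comp_add_rowMap_comp {a b b' c : ℤ × ℤ}
    {M N M' N' : Matrix (Fin 2) (Fin 2) (Env k (Alg lam eta phi))}
    (hM : ∀ i j : Fin 2, rk b ≤ j.1 → M i j = 0) (hM' : ∀ i j : Fin 2, rk b' ≤ j.1 → M' i j = 0)
    (h : M * N + M' * N' = 0) :
    ModuleCat.ofHom (rowMap lam eta phi a b M) ≫ ModuleCat.ofHom (rowMap lam eta phi b c N) +
      ModuleCat.ofHom (rowMap lam eta phi a b' M') ≫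
        ModuleCat.ofHom (rowMap lam eta phi b' c N') = 0 := by
  refine ModuleCat.hom_ext (LinearMap.ext fun w => ?_)
  change rowMap lam eta phi b c N (rowMap lam eta phi a b M w) +
    rowMap lam eta phi b' c N' (rowMap lam eta phi a b' M' w) = 0
  rw [rowMap_rowMap a b c M N hM, rowMap_rowMap a b' c M' N' hM', ← rowMap_add, h, rowMap_zero]

end rowMap

theorem rk_of_pos {p : ℤ} (hp : 1 ≤ p) {q : ℤ} (hq : q = 0 ∨ q = 1) : rk (p, q) = 2 := by
  simp only [rk, hq, if_true]
  rw [if_neg (by omega), if_neg (by omega)]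

theorem rk_zero_left {q : ℤ} (hq : q = 0 ∨ q = 1) : rk (0, q) = 1 := by
  simp [rk, hq]

theorem rk_of_neg {p : ℤ} (hp : p < 0) (q : ℤ) : rk (p, q) = 0 := by
  simp [rk, hp]

theorem rk_of_ne {p q : ℤ} (hq : q ≠ 0) (hq' : q ≠ 1) : rk (p, q) = 0 := by
  simp [rk, hq, hq']

/-- Supplies the column condition for composing row maps. It has content only when the target lies
in the column `p = 0`, of rank one; the same applies to the next three lemmas. -/
theorem dvMat_col {p : ℤ} (hp : 0 ≤ p) {q : ℤ} (hq : q = 0 ∨ q = 1) (i j : Fin 2)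
    (hj : rk (p, q) ≤ j.1) : dvMat lam eta phi p i j = 0 := by
  rcases hp.eq_or_lt with rfl | hp
  · rw [rk_zero_left hq] at hj
    obtain rfl : j = 1 := by omega
    fin_cases i <;> simp [dvMat]
  · rw [rk_of_pos (by omega) hq] at hj
    omega

theorem dhMat₀_col {p p' : ℤ} (hp : 1 ≤ p) (hp' : p' = p - 1) {q : ℤ} (hq : q = 0 ∨ q = 1)
    (i j : Fin 2) (hj : rk (p', q) ≤ j.1) : dhMat₀ lam eta phi p i j = 0 := by
  subst hp'
  rcases hp.eq_or_lt with rfl | hp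
  · rw [sub_self, rk_zero_left hq] at hj
    obtain rfl : j = 1 := by omega
    fin_cases i <;> simp [dhMat₀]
  · rw [rk_of_pos (by omega) hq] at hj
    omega

theorem dhMat₁_col {p p' : ℤ} (hp : 1 ≤ p) (hp' : p' = p - 1) {q : ℤ} (hq : q = 0 ∨ q = 1)
    (i j : Fin 2) (hj : rk (p', q) ≤ j.1) : dhMat₁ lam eta phi p i j = 0 := by
  subst hp'
  rcases hp.eq_or_lt with rfl | hp
  · rw [sub_self, rk_zero_left hq] at hj
    obtain rfl : j = 1 := by omega
    fin_cases i <;> simp [dhMat₁]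
  · rw [rk_of_pos (by omega) hq] at hj
    omega

theorem rMat_col {p p' : ℤ} (hp : 2 ≤ p) (hp' : p' = p - 2) {q : ℤ} (hq : q = 0 ∨ q = 1)
    (i j : Fin 2) (hj : rk (p', q) ≤ j.1) : rMat lam eta phi p i j = 0 := by
  subst hp'
  rcases hp.eq_or_lt with rfl | hp
  · rw [sub_self, rk_zero_left hq] at hj
    obtain rfl : j = 1 := by omega
    fin_cases i <;> simp [rMat]
  · rw [rk_of_pos (by omega) hq] at hj
    omega


theorem isZero_X {a : ℤ × ℤ} (ha : rk a = 0) : IsZero ((doubleData lam eta phi).X a) := by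
  have : IsEmpty (Fin (rk a)) := by rw [ha]; exact Fin.isEmpty
  have : Subsingleton (P lam eta phi a) := inferInstance
  exact ModuleCat.isZero_of_subsingleton (ModuleCat.of _ (P lam eta phi a))

theorem eq_zero_of_src {a : ℤ × ℤ} (ha : rk a = 0)
    {Y : ModuleCat.{u} (Env k (Alg lam eta phi))} (f : (doubleData lam eta phi).X a ⟶ Y) : f = 0 :=
  (isZero_X lam eta phi ha).eq_zero_of_src f

theorem eq_zero_of_tgt {a : ℤ × ℤ} (ha : rk a = 0)
    {Y : ModuleCat.{u} (Env k (Alg lam eta phi))} (f : Y ⟶ (doubleData lam eta phi).X a) : f = 0 :=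
  (isZero_X lam eta phi ha).eq_zero_of_tgt f

theorem dv_eq (a b : ℤ × ℤ) (h : b = (a.1, a.2 - 1)) :
    (doubleData lam eta phi).dv a b =
      ModuleCat.ofHom (rowMap lam eta phi a b (dvMat lam eta phi a.1)) :=
  if_pos h

theorem dh_eq₀ (p : ℤ) (b : ℤ × ℤ) (h : b = (p - 1, 0)) :
    (doubleData lam eta phi).dh (p, 0) b =
      ModuleCat.ofHom (rowMap lam eta phi (p, 0) b (dhMat₀ lam eta phi p)) :=
  (if_pos h).trans (by simp only [if_true]; rfl)

theorem dh_eq₁ (p : ℤ) (b : ℤ × ℤ) (h : b = (p - 1, 1)) :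
    (doubleData lam eta phi).dh (p, 1) b =
      ModuleCat.ofHom (rowMap lam eta phi (p, 1) b (dhMat₁ lam eta phi p)) :=
  (if_pos h).trans (by simp only [one_ne_zero, if_false]; rfl)

theorem r_eq (a b : ℤ × ℤ) (h : b = (a.1 - 2, a.2 + 1)) :
    (doubleData lam eta phi).r a b =
      ModuleCat.ofHom (rowMap lam eta phi a b (rMat lam eta phi a.1)) :=
  if_pos h

theorem doubleData_isHomotopyDoubleComplex : (doubleData lam eta phi).IsHomotopyDoubleComplex where
  dv_dv p q := by
    -- The composite changes the row by two, so source and target cannot both lie in the rows `0`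
    -- and `1`.
    by_cases hq : q = 0 ∨ q = 1
    · exact eq_zero_of_tgt lam eta phi (rk_of_ne (by omega) (by omega)) _
    · exact eq_zero_of_src lam eta phi (rk_of_ne (by omega) (by omega)) _
  dh_dv p q := by
    rcases lt_or_ge p 1 with hp | hp
    · exact eq_zero_of_tgt lam eta phi (rk_of_neg (by omega) _) _
    by_cases hq : q = 1
    · subst hq
      rw [show (1 : ℤ) - 1 = 0 by norm_num, dv_eq _ _ _ _ _ (by simp), dv_eq _ _ _ _ _ (by simp),
        dh_eq₀ _ _ _ _ _ rfl, dh_eq₁ _ _ _ _ _ rfl]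
      exact rowMap_comp_add_rowMap_comp (dvMat_col lam eta phi (by omega) (.inl rfl))
        (dhMat₁_col lam eta phi hp rfl (.inr rfl)) (dvMat_mul_dhMat lam eta phi p hp)
    · by_cases hq' : q = 0
      · exact eq_zero_of_tgt lam eta phi (rk_of_ne (by omega) (by omega)) _
      · exact eq_zero_of_src lam eta phi (rk_of_ne (by omega) (by omega)) _
  dh_dh p q := by
    rcases lt_or_ge p 2 with hp | hp
    · exact eq_zero_of_tgt lam eta phi (rk_of_neg (by omega) _) _
    by_cases hq : q = 0
    · subst hq
      -- In the row `q = 0` the path through `P (p, -1)` vanishes, leaving `r` followed by `d^v`. In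
      -- the row `q = 1` the path through `P (p - 2, 2)` vanishes instead, leaving `d^v` followed by
      -- `r`.
      rw [eq_zero_of_tgt lam eta phi (rk_of_ne (by omega) (by omega))
          ((doubleData lam eta phi).dv (p, 0) (p, 0 - 1)),
        Limits.zero_comp, add_zero, zero_add, dh_eq₀ _ _ _ _ _ rfl,
        dh_eq₀ _ _ _ _ _ (by ext <;> simp; omega), dv_eq _ _ _ _ _ (by simp),
        r_eq _ _ _ _ _ (by simp)]
      exact rowMap_comp_add_rowMap_comp (dhMat₀_col lam eta phi (by omega) rfl (.inl rfl))
        (rMat_col lam eta phi hp rfl (.inr rfl)) (dhMat₀_mul_dhMat₀ lam eta phi p hp)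
    by_cases hq' : q = 1
    · subst hq'
      rw [eq_zero_of_tgt lam eta phi (rk_of_ne (by omega) (by omega))
          ((doubleData lam eta phi).r (p, 1) (p - 2, 1 + 1)),
        Limits.zero_comp, add_zero, show (1 : ℤ) - 1 = 0 by norm_num, dh_eq₁ _ _ _ _ _ rfl,
        dh_eq₁ _ _ _ _ _ (by ext <;> simp; omega), dv_eq _ _ _ _ _ (by simp),
        r_eq _ _ _ _ _ (by simp)]
      exact rowMap_comp_add_rowMap_comp (dhMat₁_col lam eta phi (by omega) rfl (.inr rfl))
        (dvMat_col lam eta phi (by omega) (.inl rfl)) (dhMat₁_mul_dhMat₁ lam eta phi p hp)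
    · exact eq_zero_of_src lam eta phi (rk_of_ne (by omega) (by omega)) _
  dh_r p q := by
    rcases lt_or_ge p 3 with hp | hp
    · exact eq_zero_of_tgt lam eta phi (rk_of_neg (by omega) _) _
    by_cases hq : q = 0
    · subst hq
      rw [zero_add, dh_eq₀ _ _ _ _ _ rfl, dh_eq₁ _ _ _ _ _ (by ext <;> simp; omega),
        r_eq _ _ _ _ _ (by simp), r_eq _ _ _ _ _ (by ext <;> simp; omega)]
      exact rowMap_comp_add_rowMap_comp
        (rMat_col lam eta phi (show 2 ≤ p by omega) rfl (.inr rfl))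
        (dhMat₀_col lam eta phi (show 1 ≤ p by omega) rfl (.inl rfl))
        (rMat_mul_dhMat₁ lam eta phi p hp)
    · by_cases hq' : q = 1
      · exact eq_zero_of_tgt lam eta phi (rk_of_ne (by omega) (by omega)) _
      · exact eq_zero_of_src lam eta phi (rk_of_ne (by omega) (by omega)) _
  r_r p q := by
    by_cases hq : q = 0 ∨ q = 1
    · exact eq_zero_of_tgt lam eta phi (rk_of_ne (by omega) (by omega)) _
    · exact eq_zero_of_src lam eta phi (rk_of_ne (by omega) (by omega)) _

end PolyGWA

/-- A finitely supported sequence in which each term vanishes if the next one does is zero. -/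
theorem Finsupp.eq_zero_of_succ {M : Type*} [Zero M] (f : ℕ →₀ M)
    (h : ∀ n, f (n + 1) = 0 → f n = 0) : f = 0 := by
  by_contra hf
  have hs : f.support.Nonempty := Finsupp.support_nonempty_iff.mpr hf
  have h0 : f (f.support.max' hs) ≠ 0 := Finsupp.mem_support_iff.mp (f.support.max'_mem hs)
  refine h0 (h _ ?_)
  by_contra h1
  have := f.support.le_max' _ (Finsupp.mem_support_iff.mpr h1)
  omega

section

variable {k : Type u} [CommRing k] {A : Type u} [Ring A] [Algebra k A]

theorem bt_zero_left (v : A) : bt k 0 v = 0 := TensorProduct.zero_tmul _ _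

theorem bt_zero_right (u : A) : bt k u 0 = 0 := TensorProduct.tmul_zero _ _

theorem env_induction {motive : Env k A → Prop} (w : Env k A) (zero : motive 0)
    (add : ∀ w w', motive w → motive w' → motive (w + w')) (bt : ∀ u v, motive (bt k u v)) :
    motive w :=
  TensorProduct.induction_on w zero (fun u v => bt u v.unop) add

end

namespace PolyGWA

variable {k : Type u} [Field k] (lam : kˣ) (eta : k) (phi : k[X])

local notation "xL" => bt k (gx lam eta phi) 1
local notation "xR" => bt k 1 (gx lam eta phi)
local notation "yL" => bt k (gy lam eta phi) 1
local notation "yR" => bt k 1 (gy lam eta phi)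
local notation "zL" => bt k (gz lam eta phi) 1
local notation "zR" => bt k 1 (gz lam eta phi)

/-- The basis element `v j` of `A` over `k[z]`. -/
noncomputable abbrev gv (j : ℤ) : Alg lam eta phi := GWA.v (sigma lam eta) phi j

/-- The coordinates in the basis `v j`. -/
noncomputable abbrev crd : Alg lam eta phi ≃ₗ[k] (ℤ →₀ k[X]) := GWA.coord (sigma lam eta) phi

/-- An induction principle: `A` is spanned by the elements `p * v j`. -/
theorem induction_gv {motive : Alg lam eta phi → Prop} (c : Alg lam eta phi)
    (h : ∀ p j, motive (inc lam eta phi p * gv lam eta phi j)) (h0 : motive 0)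
    (hadd : ∀ c d, motive c → motive d → motive (c + d)) : motive c := by
  obtain ⟨m, rfl⟩ := (crd lam eta phi).symm.surjective c
  induction m using Finsupp.induction_linear with
  | zero => rwa [map_zero]
  | add f g hf hg => rw [map_add]; exact hadd _ _ hf hg
  | single j p => rw [GWA.coord_symm_single]; exact h p j

/-- The left ideal generated by `τ(z) ⊗ 1 - 1 ⊗ z`. -/
noncomputable def balIdeal (τ : k[X] →ₐ[k] k[X]) : Ideal (Env k (Alg lam eta phi)) :=
  Ideal.span {bt k (inc lam eta phi (τ X)) 1 - zR}

/-! ### Injectivity of the vertical differential -/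

section injectivity

/-- The `k`-basis `z ^ n * v j` of `Aᵒᵖ`. -/
noncomputable def opBasis : Module.Basis (Σ _ : ℤ, ℕ) k (Alg lam eta phi)ᵐᵒᵖ :=
  (Finsupp.basis fun _ : ℤ => basisMonomials k).map
    ((crd lam eta phi).symm.trans (MulOpposite.opLinearEquiv k))

/-- The coordinates of elements of `A ⊗ Aᵒᵖ` in the basis `z ^ n * v j` of `Aᵒᵖ`. -/
noncomputable def envCoord : Env k (Alg lam eta phi) ≃ₗ[k] ((Σ _ : ℤ, ℕ) →₀ Alg lam eta phi) :=
  TensorProduct.equivFinsuppOfBasisRight (opBasis lam eta phi)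

theorem envCoord_bt (b c : Alg lam eta phi) (j : ℤ) (n : ℕ) :
    envCoord lam eta phi (bt k b c) ⟨j, n⟩ = (crd lam eta phi c j).coeff n • b := by
  rw [envCoord, bt, TensorProduct.equivFinsuppOfBasisRight_apply_tmul_apply]
  simp [opBasis, Finsupp.basis_repr]
  rfl

theorem crd_gz_mul (c : Alg lam eta phi) (j : ℤ) :
    crd lam eta phi (gz lam eta phi * c) j = X * crd lam eta phi c j := by
  rw [gz, GWA.coord_ofBase_mul, Finsupp.smul_apply, smul_eq_mul]

/-- Right multiplication by `1 ⊗ z` raises the exponent of `z` in the second factor, while `s ⊗ 1`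
acts on coefficients. If the product vanishes, each coefficient is therefore the next one times `s`.
-/
theorem envCoord_mul_sub (s : Alg lam eta phi) (w : Env k (Alg lam eta phi)) (j : ℤ) (n : ℕ) :
    envCoord lam eta phi (w * (bt k s 1 - zR)) ⟨j, n + 1⟩ =
      envCoord lam eta phi w ⟨j, n + 1⟩ * s - envCoord lam eta phi w ⟨j, n⟩ := by
  induction w using env_induction with
  | zero => simp
  | add w w' h h' =>
    rw [add_mul, map_add, map_add, Finsupp.add_apply, h, h', Finsupp.add_apply, Finsupp.add_apply,
      add_mul]
    abel
  | bt b c =>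
    rw [mul_sub, map_sub, Finsupp.sub_apply, bt_mul_bt, bt_mul_bt, one_mul, mul_one, envCoord_bt,
      envCoord_bt, envCoord_bt, envCoord_bt, crd_gz_mul, coeff_X_mul, smul_mul_assoc]

/-- Right multiplication by `s ⊗ 1 - 1 ⊗ z` on `A ⊗ Aᵒᵖ` is injective. -/
theorem eq_zero_of_mul_sub (s : Alg lam eta phi) (w : Env k (Alg lam eta phi))
    (hw : w * (bt k s 1 - zR) = 0) : w = 0 := by
  refine (envCoord lam eta phi).map_eq_zero_iff.mp (Finsupp.ext fun ⟨j, n⟩ => ?_)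
  have hinj : Function.Injective fun n : ℕ => (⟨j, n⟩ : Σ _ : ℤ, ℕ) := fun m n h => by
    simpa using h
  refine DFunLike.congr_fun (Finsupp.eq_zero_of_succ
    ((envCoord lam eta phi w).comapDomain (fun n : ℕ => ⟨j, n⟩) hinj.injOn) fun n hn => ?_) n
  rw [Finsupp.comapDomain_apply] at hn ⊢
  have h := envCoord_mul_sub lam eta phi s w j n
  rw [hw, map_zero, Finsupp.zero_apply, hn, zero_mul, zero_sub] at h
  exact neg_eq_zero.mp h.symm

end injectivity

/-! ### Coordinates modulo the image of `d^v` -/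

section coefficients

/-- The linear map `b e_j ↦ b ⊗ v j`. -/
noncomputable def sec : (ℤ →₀ Alg lam eta phi) →ₗ[k] Env k (Alg lam eta phi) :=
  Finsupp.lsum k fun j => (TensorProduct.mk k _ _).flip (MulOpposite.op (gv lam eta phi j))

theorem sec_apply (f : ℤ →₀ Alg lam eta phi) :
    sec lam eta phi f = f.sum fun j b => bt k b (gv lam eta phi j) := rfl

theorem sec_single (j : ℤ) (b : Alg lam eta phi) :
    sec lam eta phi (Finsupp.single j b) = bt k b (gv lam eta phi j) := by
  simp [sec, bt]

/-- The linear map `b ⊗ (p * v j) ↦ b * τ(p) e_j`. -/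
noncomputable def coeffs (τ : k[X] →ₐ[k] k[X]) :
    Env k (Alg lam eta phi) →ₗ[k] (ℤ →₀ Alg lam eta phi) :=
  TensorProduct.lift (LinearMap.mk₂ k
    (fun b c => Finsupp.mapRange.linearMap
      (LinearMap.mulLeft k b ∘ₗ (inc lam eta phi).toLinearMap ∘ₗ τ.toLinearMap)
      (crd lam eta phi c.unop))
    (fun b b' c => Finsupp.ext fun j => by simp [add_mul])
    (fun t b c => Finsupp.ext fun j => by simp)
    (fun b c c' => by simp only [MulOpposite.unop_add, map_add])
    (fun t b c => by simp only [MulOpposite.unop_smul, map_smul]))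

theorem coeffs_bt (τ : k[X] →ₐ[k] k[X]) (b c : Alg lam eta phi) (j : ℤ) :
    coeffs lam eta phi τ (bt k b c) j = b * inc lam eta phi (τ (crd lam eta phi c j)) := by
  simp [coeffs, bt]

/-- Together with the next two lemmas this makes `sec` and `coeffs` inverse bijections between
finitely supported families in `A` and `Aᵉ` modulo `balIdeal`. -/
theorem coeffs_sec (τ : k[X] →ₐ[k] k[X]) (f : ℤ →₀ Alg lam eta phi) :
    coeffs lam eta phi τ (sec lam eta phi f) = f := by
  induction f using Finsupp.induction_linear with
  | zero => simp only [map_zero]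
  | add f g hf hg => rw [map_add, map_add, hf, hg]
  | single i b =>
    ext j
    rw [sec_single, coeffs_bt, GWA.coord_v]
    by_cases h : i = j
    · subst h; simp
    · simp [h]

/-- Both `b τ(z) ⊗ c` and `b ⊗ z c` have coefficients `b τ(z) τ(p_j)`, where `c = ∑ p_j v j`. -/
theorem coeffs_eq_zero (τ : k[X] →ₐ[k] k[X]) {w : Env k (Alg lam eta phi)}
    (hw : w ∈ balIdeal lam eta phi τ) : coeffs lam eta phi τ w = 0 := by
  obtain ⟨w, rfl⟩ := Ideal.mem_span_singleton'.mp hw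
  induction w using env_induction with
  | zero => rw [zero_mul, map_zero]
  | add w w' h h' =>
    rw [add_mul, map_add, h (Ideal.mul_mem_left _ _ (Ideal.mem_span_singleton_self _)),
      h' (Ideal.mul_mem_left _ _ (Ideal.mem_span_singleton_self _)), add_zero]
  | bt b c =>
    ext j
    rw [mul_sub, map_sub, bt_mul_bt, bt_mul_bt, Finsupp.sub_apply, coeffs_bt, coeffs_bt, one_mul,
      crd_gz_mul, map_mul, map_mul, mul_one, mul_assoc, sub_self, Finsupp.zero_apply]

/-- A polynomial `p` crosses the tensor sign as `τ(p)`: the difference `τ(p) ⊗ 1 - 1 ⊗ p` is a left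
multiple of `τ(z) ⊗ 1 - 1 ⊗ z`, with the twisted divided difference as the cofactor. -/
theorem sub_sec_coeffs_mem (τ : k[X] →ₐ[k] k[X]) (w : Env k (Alg lam eta phi)) :
    w - sec lam eta phi (coeffs lam eta phi τ w) ∈ balIdeal lam eta phi τ := by
  induction w using env_induction with
  | zero => simp
  | add w w' h h' =>
    rw [map_add, map_add, add_sub_add_comm]
    exact add_mem h h'
  | bt b c =>
    induction c using induction_gv lam eta phi with
    | h0 => simp [bt_zero_right]
    | hadd c d hc hd =>
      rw [bt_add_right, map_add, map_add, add_sub_add_comm]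
      exact add_mem hc hd
    | h p j =>
      have h : coeffs lam eta phi τ (bt k b (inc lam eta phi p * gv lam eta phi j)) =
          Finsupp.single j (b * inc lam eta phi (τ p)) := by
        ext i
        rw [coeffs_bt, GWA.coord_ofBase_mul, GWA.coord_v]
        by_cases h : j = i
        · subst h; simp
        · simp [h]
      have h' := delta_mul_sub lam eta phi τ (.id k _) p
      rw [h, sec_single]
      refine sub_mem_comm_iff.mp (Ideal.mem_span_singleton'.mpr
        ⟨bt k b (gv lam eta phi j) * delta lam eta phi τ.toLinearMap LinearMap.id p, ?_⟩)
      rw [mul_assoc]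
      refine (congrArg (fun t => bt k b (gv lam eta phi j) * t) h').trans ?_
      rw [mul_sub, bt_mul_bt, bt_mul_bt, one_mul, mul_one]
      rfl

theorem eq_zero_of_sec_mem (τ : k[X] →ₐ[k] k[X]) {f : ℤ →₀ Alg lam eta phi}
    (hf : sec lam eta phi f ∈ balIdeal lam eta phi τ) : f = 0 := by
  rw [← coeffs_sec lam eta phi τ f, coeffs_eq_zero lam eta phi τ hf]

/-- Multiplication of all coefficients by `c` on the right. -/
noncomputable abbrev rmul (c : Alg lam eta phi) :
    (ℤ →₀ Alg lam eta phi) →ₗ[k] (ℤ →₀ Alg lam eta phi) :=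
  Finsupp.mapRange.linearMap (LinearMap.mulRight k c)

theorem sec_mul_bt (f : ℤ →₀ Alg lam eta phi) (c : Alg lam eta phi) :
    sec lam eta phi f * bt k c 1 = sec lam eta phi (rmul lam eta phi c f) := by
  induction f using Finsupp.induction_linear with
  | zero => simp only [map_zero, zero_mul]
  | add f g hf hg => rw [map_add, map_add, map_add, add_mul, hf, hg]
  | single i b => simp [sec_single, bt_mul_bt, -Finsupp.single_mul]

/-- The support condition makes `x * v j = v (j + 1)` hold exactly; on negative indices a factor
`σ(φ)` would appear. The condition for `1 ⊗ y` is the mirror image. -/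
theorem sec_mul_xR (f : ℤ →₀ Alg lam eta phi) (hf : ∀ j < 0, f j = 0) :
    sec lam eta phi f * xR = sec lam eta phi (f.mapDomain (· + 1)) := by
  rw [sec_apply, sec_apply, Finsupp.sum_mapDomain_index (h := fun j b => bt k b (gv lam eta phi j))
    (fun _ => bt_zero_left _) (fun _ _ _ => bt_add_left _ _ _), Finsupp.sum, Finset.sum_mul]
  refine Finset.sum_congr rfl fun j hj => ?_
  have h : 0 ≤ j := not_lt.mp fun h => Finsupp.mem_support_iff.mp hj (hf j h)
  rw [bt_mul_bt, mul_one]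
  exact congrArg (bt k (f j)) (GWA.x_mul_v _ _ h)

theorem sec_mul_yR (f : ℤ →₀ Alg lam eta phi) (hf : ∀ j > 0, f j = 0) :
    sec lam eta phi f * yR = sec lam eta phi (f.mapDomain (· - 1)) := by
  rw [sec_apply, sec_apply, Finsupp.sum_mapDomain_index (h := fun j b => bt k b (gv lam eta phi j))
    (fun _ => bt_zero_left _) (fun _ _ _ => bt_add_left _ _ _), Finsupp.sum, Finset.sum_mul]
  refine Finset.sum_congr rfl fun j hj => ?_
  have h : j ≤ 0 := not_lt.mp fun h => Finsupp.mem_support_iff.mp hj (hf j h)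
  rw [bt_mul_bt, mul_one]
  exact congrArg (bt k (f j)) (GWA.y_mul_v _ _ h)

theorem mapDomain_add_one_apply {M : Type*} [AddCommMonoid M] (f : ℤ →₀ M) (j : ℤ) :
    f.mapDomain (· + 1) j = f (j - 1) := by
  conv_lhs => rw [← sub_add_cancel j 1]
  exact Finsupp.mapDomain_apply (add_left_injective 1) f (j - 1)

theorem mapDomain_sub_one_apply {M : Type*} [AddCommMonoid M] (f : ℤ →₀ M) (j : ℤ) :
    f.mapDomain (· - 1) j = f (j + 1) := by
  conv_lhs => rw [← add_sub_cancel_right j 1]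
  exact Finsupp.mapDomain_apply (sub_left_injective (b := (1 : ℤ))) f (j + 1)

/-- Modulo the balancing ideal every element is a combination of `v j`, `j ≥ 0`, plus a right
multiple of `1 ⊗ y`. -/
theorem exists_split_y (τ : k[X] →ₐ[k] k[X]) (w : Env k (Alg lam eta phi)) :
    ∃ f g : ℤ →₀ Alg lam eta phi, (∀ j < 0, f j = 0) ∧ (∀ j > 0, g j = 0) ∧
      w - (sec lam eta phi f + sec lam eta phi g * yR) ∈ balIdeal lam eta phi τ := by
  set F := coeffs lam eta phi τ w
  have hg : ∀ j > 0, (F.filter (¬ 0 ≤ ·)).mapDomain (· + 1) j = 0 := fun j hj => by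
    rw [mapDomain_add_one_apply, Finsupp.filter_apply_neg]
    omega
  -- The part with `j ≤ -1` is raised by one, landing in `j ≤ 0`, where `1 ⊗ y` undoes the shift.
  refine ⟨F.filter (0 ≤ ·), (F.filter (¬ 0 ≤ ·)).mapDomain (· + 1), fun j hj => ?_, hg, ?_⟩
  · exact Finsupp.filter_apply_neg _ _ (by omega)
  · have h : ((F.filter (¬ 0 ≤ ·)).mapDomain (· + 1)).mapDomain (· - 1) = F.filter (¬ 0 ≤ ·) := by
      ext j
      rw [mapDomain_sub_one_apply, mapDomain_add_one_apply, add_sub_cancel_right]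
    rw [sec_mul_yR lam eta phi _ hg, h, ← map_add, Finsupp.filter_add_filter_not]
    exact sub_sec_coeffs_mem lam eta phi τ w

/-- The mirror splitting: the indices `j ≤ 0` are kept, and the part with `j ≥ 1` is a right
multiple of `1 ⊗ x`. -/
theorem exists_split_x (τ : k[X] →ₐ[k] k[X]) (w : Env k (Alg lam eta phi)) :
    ∃ f g : ℤ →₀ Alg lam eta phi, (∀ j < 0, f j = 0) ∧ (∀ j > 0, g j = 0) ∧
      w - (sec lam eta phi g + sec lam eta phi f * xR) ∈ balIdeal lam eta phi τ := by
  set F := coeffs lam eta phi τ w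
  have hf : ∀ j < 0, (F.filter (¬ · ≤ 0)).mapDomain (· - 1) j = 0 := fun j hj => by
    rw [mapDomain_sub_one_apply, Finsupp.filter_apply_neg]
    omega
  refine ⟨(F.filter (¬ · ≤ 0)).mapDomain (· - 1), F.filter (· ≤ 0), hf, fun j hj => ?_, ?_⟩
  · exact Finsupp.filter_apply_neg _ _ (by omega)
  · have h : ((F.filter (¬ · ≤ 0)).mapDomain (· - 1)).mapDomain (· + 1) = F.filter (¬ · ≤ 0) := by
      ext j
      rw [mapDomain_add_one_apply, mapDomain_sub_one_apply, sub_add_cancel]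
    rw [sec_mul_xR lam eta phi _ hf, h, ← map_add, Finsupp.filter_add_filter_not]
    exact sub_sec_coeffs_mem lam eta phi τ w

end coefficients

end PolyGWA

namespace PolyGWA

variable {k : Type u} [Field k] (lam : kˣ) (eta : k) (phi : k[X])

local notation "xL" => bt k (gx lam eta phi) 1
local notation "xR" => bt k 1 (gx lam eta phi)
local notation "yL" => bt k (gy lam eta phi) 1
local notation "yR" => bt k 1 (gy lam eta phi)
local notation "zL" => bt k (gz lam eta phi) 1
local notation "zR" => bt k 1 (gz lam eta phi)

/-! ### Normal forms are detected by their supports -/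

section independence

variable (τ : k[X] →ₐ[k] k[X]) {f g : ℤ →₀ Alg lam eta phi} (hf : ∀ j < 0, f j = 0)
  (hg : ∀ j > 0, g j = 0)

include hf hg

/-- The first summand has coefficients only in `j ≥ 0` and the second only in `j ≤ -1`, so they
vanish separately. Nothing follows for `f`, since `c` may be a zero divisor; the other component of
`d^h` handles it. -/
theorem eq_zero_of_mul_yR_mem (c : Alg lam eta phi) {t : k} (ht : t ≠ 0)
    (h : sec lam eta phi f * bt k c 1 + t • (sec lam eta phi g * yR) ∈ balIdeal lam eta phi τ) :
    g = 0 := by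
  rw [sec_mul_bt, sec_mul_yR lam eta phi g hg, ← map_smul, ← map_add] at h
  have h := eq_zero_of_sec_mem lam eta phi τ h
  ext j
  rcases lt_or_ge 0 j with hj | hj
  · exact hg j hj
  · have h := DFunLike.congr_fun h (j - 1)
    simpa [mapDomain_sub_one_apply, hf (j - 1) (by omega), ht] using h

theorem eq_zero_of_mul_xR_mem (c : Alg lam eta phi) {t : k} (ht : t ≠ 0)
    (h : sec lam eta phi g * bt k c 1 + t • (sec lam eta phi f * xR) ∈ balIdeal lam eta phi τ) :
    f = 0 := by
  rw [sec_mul_bt, sec_mul_xR lam eta phi f hf, ← map_smul, ← map_add] at h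
  have h := eq_zero_of_sec_mem lam eta phi τ h
  ext j
  rcases lt_or_ge j 0 with hj | hj
  · exact hf j hj
  · have h := DFunLike.congr_fun h (j + 1)
    simpa [mapDomain_add_one_apply, hg (j + 1) (by omega), ht] using h

/-- The coefficient at `j` reads `f_j x - f_{j-1} + g_j y - g_{j+1} = 0`. For `j ≥ 1` it becomes
`f_{j-1} = f_j x`, for `j ≤ -1` it becomes `g_{j+1} = g_j y`, and finite support forces both
families to vanish. -/
theorem eq_zero_of_mul_sub_mem
    (h : sec lam eta phi f * (xL - xR) + sec lam eta phi g * (yL - yR) ∈ balIdeal lam eta phi τ) :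
    f = 0 ∧ g = 0 := by
  rw [mul_sub, mul_sub, sec_mul_bt, sec_mul_bt, sec_mul_xR lam eta phi f hf,
    sec_mul_yR lam eta phi g hg, ← map_sub, ← map_sub, ← map_add] at h
  have h (j : ℤ) := DFunLike.congr_fun (eq_zero_of_sec_mem lam eta phi τ h) j
  simp only [Finsupp.add_apply, Finsupp.sub_apply, mapDomain_sub_one_apply, Finsupp.zero_apply,
    mapDomain_add_one_apply, Finsupp.mapRange.linearMap_apply, Finsupp.mapRange_apply,
    LinearMap.mulRight_apply] at h
  constructor
  · have hi : Function.Injective fun n : ℕ => (n : ℤ) := Nat.cast_injective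
    have h0 := Finsupp.eq_zero_of_succ (f.comapDomain (fun n : ℕ => (n : ℤ)) hi.injOn)
      fun n hn => by
        have h := h (n + 1)
        rw [Finsupp.comapDomain_apply, Nat.cast_succ] at hn
        rw [hn, hg _ (by omega), hg _ (by omega), add_sub_cancel_right] at h
        simpa using h
    ext j
    rcases lt_or_ge j 0 with hj | hj
    · exact hf j hj
    · lift j to ℕ using hj
      exact DFunLike.congr_fun h0 j
  · have hi : Function.Injective fun n : ℕ => -(n : ℤ) := fun m n h => by simpa using h
    have h0 := Finsupp.eq_zero_of_succ (g.comapDomain (fun n : ℕ => -(n : ℤ)) hi.injOn)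
      fun n hn => by
        have h := h (-(n : ℤ) - 1)
        rw [Finsupp.comapDomain_apply, Nat.cast_succ, neg_add'] at hn
        rw [hn, hf _ (by omega), hf _ (by omega), sub_add_cancel] at h
        simpa using h
    ext j
    rcases lt_or_ge 0 j with hj | hj
    · exact hg j hj
    · obtain ⟨n, rfl⟩ : ∃ n : ℕ, j = -n := ⟨(-j).toNat, by omega⟩
      exact DFunLike.congr_fun h0 n

end independence

/-! ### Exactness of the row `q = 0` modulo `d^v` in positive degrees -/

section rows

theorem vecMul_fin_two {E : Type*} [Ring E] (w : Fin 2 → E) (m₁₁ m₁₂ m₂₁ m₂₂ : E) :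
    Matrix.vecMul w !![m₁₁, m₁₂; m₂₁, m₂₂] =
      ![w 0 * m₁₁ + w 1 * m₂₁, w 0 * m₁₂ + w 1 * m₂₂] := by
  ext i
  fin_cases i <;> simp [Matrix.vecMul, dotProduct, Fin.sum_univ_two]

/-- The diagonal entries of `d^v_p` for `p ≥ 1`. -/
theorem dvMat_of_odd {p : ℤ} (hp : Odd p) : dvMat lam eta phi p =
    !![bt k (inc lam eta phi (sigma lam eta X)) 1 - zR, 0;
       0, bt k (inc lam eta phi ((sigma lam eta).symm X)) 1 - zR] := by
  have h0 : p ≠ 0 := by grind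
  unfold dvMat
  simp only [h0, hp, if_true, if_false]
  rfl

theorem dvMat_of_even {p : ℤ} (h0 : p ≠ 0) (hp : ¬ Odd p) : dvMat lam eta phi p =
    !![zL - zR, 0; 0, zL - zR] := by
  unfold dvMat
  simp only [h0, hp, if_false]

theorem dvMat_zero : dvMat lam eta phi 0 = !![zL - zR, 0; 0, 0] := by
  unfold dvMat
  simp only [if_true]

theorem vecMul_dvMat_injective {p : ℤ} (hp : p ≠ 0) (w : Fin 2 → Env k (Alg lam eta phi))
    (hw : Matrix.vecMul w (dvMat lam eta phi p) = 0) : w = 0 := by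
  by_cases h : Odd p
  · rw [dvMat_of_odd lam eta phi h, vecMul_fin_two] at hw
    ext i
    fin_cases i
    · exact eq_zero_of_mul_sub lam eta phi _ (w 0) (by simpa using congrFun hw 0)
    · exact eq_zero_of_mul_sub lam eta phi _ (w 1) (by simpa using congrFun hw 1)
  · rw [dvMat_of_even lam eta phi hp h, vecMul_fin_two] at hw
    ext i
    fin_cases i
    · exact eq_zero_of_mul_sub lam eta phi _ (w 0) (by simpa using congrFun hw 0)
    · exact eq_zero_of_mul_sub lam eta phi _ (w 1) (by simpa using congrFun hw 1)

/-- In the row `q = 0`, every element of `P (p, 0)`, `p ≥ 1`, is congruent to a normal form modulo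
the images of `dh` and `dv`. -/
theorem exists_normal_form {p : ℤ} (hp : 1 ≤ p) (w : Fin 2 → Env k (Alg lam eta phi)) :
    ∃ (a b : Fin 2 → Env k (Alg lam eta phi)) (f g : ℤ →₀ Alg lam eta phi),
      (∀ j < 0, f j = 0) ∧ (∀ j > 0, g j = 0) ∧
      w = Matrix.vecMul a (dhMat₀ lam eta phi (p + 1)) +
        ![sec lam eta phi f, sec lam eta phi g] + Matrix.vecMul b (dvMat lam eta phi p) := by
  have h1 : p + 1 ≠ 1 := by omega
  have h2 : p ≠ 0 := by omega
  by_cases h : Odd p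
  · have h3 : ¬ Odd (p + 1) := by grind
    obtain ⟨f₀, g₀, hf₀, hg₀, h₀⟩ := exists_split_y lam eta phi (sigma lam eta).toAlgHom (w 0)
    obtain ⟨f₁, g₁, hf₁, hg₁, h₁⟩ := exists_split_x lam eta phi (sigma lam eta).symm.toAlgHom (w 1)
    obtain ⟨b₀, hb₀⟩ := Ideal.mem_span_singleton'.mp h₀
    obtain ⟨b₁, hb₁⟩ := Ideal.mem_span_singleton'.mp h₁
    -- The bad parts are `g₀ * (1 ⊗ y)` in the first component and `f₁ * (1 ⊗ x)` in the second. The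
    -- pair `(f₁, g₀)` has `d^h`-image containing both; the by-products `f₁ * (y ⊗ 1)` and `g₀ * (x
    -- ⊗ 1)` keep the allowed supports and are absorbed into `f` and `g`.
    refine ⟨![sec lam eta phi f₁, sec lam eta phi g₀], ![b₀, b₁],
      f₀ - rmul lam eta phi (gy lam eta phi) f₁, g₁ - rmul lam eta phi (gx lam eta phi) g₀,
      fun j hj => ?_, fun j hj => ?_, ?_⟩
    · simp [hf₀ j hj, hf₁ j hj]
    · simp [hg₀ j hj, hg₁ j hj]
    · rw [dvMat_of_odd lam eta phi h, dhMat₀, if_neg h1, if_neg h3, vecMul_fin_two, vecMul_fin_two]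
      rw [map_sub, map_sub, ← sec_mul_bt, ← sec_mul_bt]
      ext i
      fin_cases i
      · change w 0 = sec lam eta phi f₁ * yL + sec lam eta phi g₀ * yR +
          (sec lam eta phi f₀ - sec lam eta phi f₁ * yL) + (b₀ * _ + b₁ * 0)
        rw [mul_zero, add_zero]
        refine Eq.trans ?_ (congrArg (_ + ·) hb₀.symm)
        abel
      · change w 1 = sec lam eta phi f₁ * xR + sec lam eta phi g₀ * xL +
          (sec lam eta phi g₁ - sec lam eta phi g₀ * xL) + (b₀ * 0 + b₁ * _)
        rw [mul_zero, zero_add]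
        refine Eq.trans ?_ (congrArg (_ + ·) hb₁.symm)
        abel
  · have h3 : Odd (p + 1) := by grind
    obtain ⟨f₀, g₀, hf₀, hg₀, h₀⟩ := exists_split_y lam eta phi (.id k _) (w 0)
    obtain ⟨f₁, g₁, hf₁, hg₁, h₁⟩ := exists_split_x lam eta phi (.id k _) (w 1)
    obtain ⟨b₀, hb₀⟩ := Ideal.mem_span_singleton'.mp h₀
    obtain ⟨b₁, hb₁⟩ := Ideal.mem_span_singleton'.mp h₁
    -- The same cancellation; the sign compensates the minus signs on `1 ⊗ x` and `1 ⊗ y` in the odd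
    -- `d^h`.
    refine ⟨![(-1 : k) • sec lam eta phi f₁, (-1 : k) • sec lam eta phi g₀], ![b₀, b₁],
      f₀ + rmul lam eta phi (gx lam eta phi) f₁, g₁ + rmul lam eta phi (gy lam eta phi) g₀,
      fun j hj => ?_, fun j hj => ?_, ?_⟩
    · simp [hf₀ j hj, hf₁ j hj]
    · simp [hg₀ j hj, hg₁ j hj]
    · rw [dvMat_of_even lam eta phi h2 h, dhMat₀, if_neg h1, if_pos h3, vecMul_fin_two,
        vecMul_fin_two]
      rw [map_add, map_add, ← sec_mul_bt, ← sec_mul_bt]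
      ext i
      fin_cases i
      · change w 0 = ((-1 : k) • sec lam eta phi f₁) * xL + ((-1 : k) • sec lam eta phi g₀) * -yR +
          (sec lam eta phi f₀ + sec lam eta phi f₁ * xL) + (b₀ * _ + b₁ * 0)
        rw [mul_zero, add_zero]
        refine Eq.trans ?_ (congrArg (_ + ·) hb₀.symm)
        simp only [env_neg, env_sub, smul_mul_assoc, mul_smul_comm]
        module
      · change w 1 = ((-1 : k) • sec lam eta phi f₁) * -xR + ((-1 : k) • sec lam eta phi g₀) * yL +
          (sec lam eta phi g₁ + sec lam eta phi g₀ * yL) + (b₀ * 0 + b₁ * _)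
        rw [mul_zero, zero_add]
        refine Eq.trans ?_ (congrArg (_ + ·) hb₁.symm)
        simp only [env_neg, env_sub, smul_mul_assoc, mul_smul_comm]
        module

/-- A normal form whose image under `dh` lies in the image of `dv` is zero. -/
theorem normal_form_eq_zero {p : ℤ} (hp : 1 ≤ p) {f g : ℤ →₀ Alg lam eta phi}
    (hf : ∀ j < 0, f j = 0) (hg : ∀ j > 0, g j = 0) (c : Fin 2 → Env k (Alg lam eta phi))
    (h : Matrix.vecMul ![sec lam eta phi f, sec lam eta phi g] (dhMat₀ lam eta phi p) =
      Matrix.vecMul c (dvMat lam eta phi (p - 1))) : f = 0 ∧ g = 0 := by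
  by_cases h1 : p = 1
  · subst h1
    rw [sub_self, dvMat_zero, dhMat₀, if_pos rfl, vecMul_fin_two, vecMul_fin_two] at h
    have h0 : sec lam eta phi f * (xL - xR) + sec lam eta phi g * (yL - yR) =
      c 0 * (zL - zR) + c 1 * 0 := congrFun h 0
    rw [mul_zero, add_zero] at h0
    exact eq_zero_of_mul_sub_mem lam eta phi (.id k _) hf hg
      (Ideal.mem_span_singleton'.mpr ⟨c 0, h0.symm⟩)
  by_cases h2 : Odd p
  · rw [dvMat_of_even lam eta phi (by omega) (by grind), dhMat₀, if_neg h1, if_pos h2,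
      vecMul_fin_two, vecMul_fin_two] at h
    have h0 : sec lam eta phi f * xL + sec lam eta phi g * -yR =
      c 0 * (zL - zR) + c 1 * 0 := congrFun h 0
    have h1 : sec lam eta phi f * -xR + sec lam eta phi g * yL =
      c 0 * 0 + c 1 * (zL - zR) := congrFun h 1
    rw [mul_zero, add_zero, env_neg, mul_smul_comm] at h0
    rw [mul_zero, zero_add, env_neg, mul_smul_comm, add_comm] at h1
    have ht : (-1 : k) ≠ 0 := neg_ne_zero.mpr one_ne_zero
    exact ⟨eq_zero_of_mul_xR_mem lam eta phi (.id k _) hf hg _ ht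
        (Ideal.mem_span_singleton'.mpr ⟨c 1, h1.symm⟩),
      eq_zero_of_mul_yR_mem lam eta phi (.id k _) hf hg _ ht
        (Ideal.mem_span_singleton'.mpr ⟨c 0, h0.symm⟩)⟩
  · rw [dvMat_of_odd lam eta phi (by grind), dhMat₀, if_neg h1, if_neg h2,
      vecMul_fin_two, vecMul_fin_two] at h
    have h0 : sec lam eta phi f * yL + sec lam eta phi g * yR = c 0 * _ + c 1 * 0 := congrFun h 0
    have h1 : sec lam eta phi f * xR + sec lam eta phi g * xL = c 0 * 0 + c 1 * _ := congrFun h 1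
    rw [mul_zero, add_zero, ← one_smul k (sec lam eta phi g * yR)] at h0
    rw [mul_zero, zero_add, add_comm, ← one_smul k (sec lam eta phi f * xR)] at h1
    exact ⟨eq_zero_of_mul_xR_mem lam eta phi (sigma lam eta).symm.toAlgHom hf hg _ one_ne_zero
        (Ideal.mem_span_singleton'.mpr ⟨c 1, h1.symm⟩),
      eq_zero_of_mul_yR_mem lam eta phi (sigma lam eta).toAlgHom hf hg _ one_ne_zero
        (Ideal.mem_span_singleton'.mpr ⟨c 0, h0.symm⟩)⟩

/-- Exactness of the row `q = 0` modulo the image of `dv`. -/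
theorem exists_of_vecMul_dhMat₀ {p : ℤ} (hp : 1 ≤ p) (w u : Fin 2 → Env k (Alg lam eta phi))
    (h : Matrix.vecMul w (dhMat₀ lam eta phi p) +
      Matrix.vecMul u (dvMat lam eta phi (p - 1)) = 0) :
    ∃ a b, Matrix.vecMul a (dhMat₀ lam eta phi (p + 1)) +
      Matrix.vecMul b (dvMat lam eta phi p) = w := by
  obtain ⟨a, b, f, g, hf, hg, rfl⟩ := exists_normal_form lam eta phi hp w
  have e₁ := congrArg (Matrix.vecMul a) (dhMat₀_mul_dhMat₀ lam eta phi (p + 1) (by omega))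
  have e₂ := congrArg (Matrix.vecMul b) (dvMat_mul_dhMat lam eta phi p hp)
  rw [show p + 1 - 1 = p by omega, show p + 1 - 2 = p - 1 by omega] at e₁
  simp only [Matrix.vecMul_add, Matrix.vecMul_zero, ← Matrix.vecMul_vecMul] at e₁ e₂
  simp only [Matrix.add_vecMul] at h
  -- Modulo `d^v`, the `d^h`-images of the other two summands vanish, because `d^h d^h = -r d^v` in
  -- this row and `d^h` anticommutes with `d^v`. The normal form is therefore itself a cycle modulo
  -- `d^v`, with the displayed preimage.
  obtain ⟨rfl, rfl⟩ := normal_form_eq_zero lam eta phi hp hf hg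
    (Matrix.vecMul a (rMat lam eta phi (p + 1)) + Matrix.vecMul b (dhMat₁ lam eta phi p) - u) (by
      rw [Matrix.sub_vecMul, Matrix.add_vecMul, eq_neg_of_add_eq_zero_right e₁,
        eq_neg_of_add_eq_zero_right e₂, ← sub_eq_zero, ← h]
      abel)
  refine ⟨a, b, ?_⟩
  have h0 : ![sec lam eta phi 0, sec lam eta phi 0] = 0 := by
    rw [map_zero]
    ext i
    fin_cases i <;> rfl
  rw [h0, add_zero]

end rows

/-! ### The kernel of the multiplication map -/

section augmentation

/-- The left ideal generated by `x ⊗ 1 - 1 ⊗ x`, `y ⊗ 1 - 1 ⊗ y` and `z ⊗ 1 - 1 ⊗ z`. -/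
noncomputable def augIdeal : Ideal (Env k (Alg lam eta phi)) :=
  Ideal.span {xL - xR, yL - yR, zL - zR}

/-- The elements `c` with this property form a subalgebra, by a Leibniz-type identity for products,
and polynomials in `z` belong to it by the divided difference identity. -/
theorem bt_sub_bt_mem_augIdeal (c : Alg lam eta phi) :
    bt k c 1 - bt k 1 c ∈ augIdeal lam eta phi := by
  let S : Subalgebra k (Alg lam eta phi) :=
    { carrier := {c | bt k c 1 - bt k 1 c ∈ augIdeal lam eta phi}
      mul_mem' := fun {c d} hc hd => by
        have h : bt k (c * d) 1 - bt k 1 (c * d) =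
            bt k c 1 * (bt k d 1 - bt k 1 d) + bt k 1 d * (bt k c 1 - bt k 1 c) := by
          simp only [mul_sub, bt_mul_bt, one_mul, mul_one]
          abel
        rw [Set.mem_ofPred_eq, h]
        exact add_mem (Ideal.mul_mem_left _ _ hd) (Ideal.mul_mem_left _ _ hc)
      add_mem' := fun {c d} hc hd => by
        rw [Set.mem_ofPred_eq, bt_add_left, bt_add_right, add_sub_add_comm]
        exact add_mem hc hd
      algebraMap_mem' := fun t => by
        rw [Set.mem_ofPred_eq, Algebra.algebraMap_eq_smul_one, bt_smul_left, bt_smul_right,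
          sub_self]
        exact zero_mem _ }
  refine GWA.mem_of_generators S (fun p => ?_) ?_ ?_ c
  · exact Eq.mp (congrArg (· ∈ augIdeal lam eta phi)
      (delta_mul_sub lam eta phi (.id k _) (.id k _) p))
      (Ideal.mul_mem_left _ _ (Ideal.subset_span (Or.inr (Or.inr rfl))))
  · exact Ideal.subset_span (Or.inl rfl)
  · exact Ideal.subset_span (Or.inr (Or.inl rfl))

/-- Modulo the ideal `b ⊗ c` equals `b c ⊗ 1`, so an element is determined by its product in `A`. -/
theorem sub_bt_smul_one_mem_augIdeal (w : Env k (Alg lam eta phi)) :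
    w - bt k (w • (1 : Alg lam eta phi)) 1 ∈ augIdeal lam eta phi := by
  induction w using env_induction with
  | zero =>
    have h : (0 : Env k (Alg lam eta phi)) • (1 : Alg lam eta phi) = 0 :=
      zero_smul (Env k (Alg lam eta phi)) (1 : Alg lam eta phi)
    rw [h, bt_zero_left, sub_zero]
    exact zero_mem _
  | add w w' h h' =>
    rw [add_smul, bt_add_left, add_sub_add_comm]
    exact add_mem h h'
  | bt b c =>
    have h : bt k b c • (1 : Alg lam eta phi) = b * c := by
      rw [bt, env_smul_def, mul_one]
    rw [h]
    refine sub_mem_comm_iff.mp ?_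
    have h' : bt k (b * c) 1 - bt k b c = bt k b 1 * (bt k c 1 - bt k 1 c) := by
      simp only [mul_sub, bt_mul_bt, mul_one]
    rw [h']
    exact Ideal.mul_mem_left _ _ (bt_sub_bt_mem_augIdeal lam eta phi c)

/-- Exactness of the row `q = 0` at `P (0, 0)` modulo the image of `dv`. -/
theorem exists_of_smul_one_eq_zero (w : Env k (Alg lam eta phi))
    (h : w • (1 : Alg lam eta phi) = 0) :
    ∃ a₁ a₂ b, a₁ * (xL - xR) + a₂ * (yL - yR) + b * (zL - zR) = w := by
  have h' := sub_bt_smul_one_mem_augIdeal lam eta phi w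
  rw [h, bt_zero_left, sub_zero] at h'
  obtain ⟨a₁, a₂, b, h⟩ := Submodule.mem_span_triple.mp h'
  exact ⟨a₁, a₂, b, h⟩

end augmentation

end PolyGWA

namespace PolyGWA

variable {k : Type u} [Field k] (lam : kˣ) (eta : k) (phi : k[X])

/-! ### The total complex as a two-row complex -/

section total

local notation "DD" => doubleData lam eta phi

theorem totι_zero_of_rk (n : ℤ) (a : ℤ × ℤ) (h : a.1 + a.2 = n) (ha : rk a = 0) :
    (DD).totι n a h = 0 :=
  eq_zero_of_src lam eta phi ha _

open Classical in
/-- The projection of `Tot_n` onto the summand `P a`. -/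
noncomputable def totπ (n : ℤ) (a : ℤ × ℤ) (h : a.1 + a.2 = n) : (DD).totX n ⟶ (DD).X a :=
  Sigma.π (fun a : {a : ℤ × ℤ // a.1 + a.2 = n} => (DD).X a.1) ⟨a, h⟩

theorem totι_totπ (n : ℤ) (a : ℤ × ℤ) (h : a.1 + a.2 = n) :
    (DD).totι n a h ≫ totπ lam eta phi n a h = 𝟙 _ := by
  classical
  exact Sigma.ι_π_eq_id (fun a : {a : ℤ × ℤ // a.1 + a.2 = n} => (DD).X a.1) ⟨a, h⟩

theorem totι_totπ_of_ne (n : ℤ) (a b : ℤ × ℤ) (h : a.1 + a.2 = n) (h' : b.1 + b.2 = n)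
    (hab : a ≠ b) : (DD).totι n a h ≫ totπ lam eta phi n b h' = 0 := by
  classical
  exact Sigma.ι_π_of_ne (fun a : {a : ℤ × ℤ // a.1 + a.2 = n} => (DD).X a.1)
    (fun e => hab (congrArg Subtype.val e))

theorem totX_id (n : ℤ) : 𝟙 ((DD).totX n) =
    totπ lam eta phi n (n, 0) (by simp) ≫ (DD).totι n (n, 0) (by simp) +
    totπ lam eta phi n (n - 1, 1) (by simp) ≫ (DD).totι n (n - 1, 1) (by simp) := by
  refine Sigma.hom_ext _ _ ?_
  rintro ⟨a, ha⟩
  change (DD).totι n a ha ≫ 𝟙 _ = (DD).totι n a ha ≫ _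
  rw [Category.comp_id, Preadditive.comp_add, ← Category.assoc, ← Category.assoc]
  by_cases h0 : a = (n, 0)
  · subst h0
    rw [totι_totπ, totι_totπ_of_ne _ _ _ _ _ _ _ _ (by simp), Category.id_comp,
      Limits.zero_comp, add_zero]
  by_cases h1 : a = (n - 1, 1)
  · subst h1
    rw [totι_totπ, totι_totπ_of_ne _ _ _ _ _ _ _ _ (by simp), Category.id_comp,
      Limits.zero_comp, zero_add]
  have hr : rk a = 0 := by
    obtain ⟨p, q⟩ := a
    simp only [Prod.mk.injEq, not_and] at h0 h1 ha
    exact rk_of_ne (by omega) (by omega)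
  rw [totι_zero_of_rk _ _ _ _ _ _ hr, Limits.zero_comp, Limits.zero_comp, Limits.zero_comp,
    Limits.zero_comp, add_zero]

theorem exists_eq_totι_add (n : ℤ) (t : (DD).totX n) :
    ∃ (a : (DD).X (n, 0)) (b : (DD).X (n - 1, 1)),
      t = (DD).totι n (n, 0) (by simp) a + (DD).totι n (n - 1, 1) (by simp) b :=
  ⟨totπ lam eta phi n (n, 0) (by simp) t, totπ lam eta phi n (n - 1, 1) (by simp) t,
    congrArg (fun f : (DD).totX n ⟶ (DD).totX n => f t) (totX_id lam eta phi n)⟩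

theorem totπ_totι_add (n : ℤ) (a : (DD).X (n, 0)) (b : (DD).X (n - 1, 1)) :
    totπ lam eta phi n (n, 0) (by simp)
      ((DD).totι n (n, 0) (by simp) a + (DD).totι n (n - 1, 1) (by simp) b) = a := by
  rw [map_add]
  have h₀ := congrArg (fun f : (DD).X (n, 0) ⟶ (DD).X (n, 0) => f a)
    (totι_totπ lam eta phi n (n, 0) (by simp))
  have h₁ := congrArg (fun f : (DD).X (n - 1, 1) ⟶ (DD).X (n, 0) => f b)
    (totι_totπ_of_ne lam eta phi n (n - 1, 1) (n, 0) (by simp) (by simp) (by simp))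
  exact (congrArg₂ (· + ·) h₀ h₁).trans (add_zero a)

theorem totd_totι_zero (n m : ℤ) (h : m + 1 = n) (a : (DD).X (n, 0)) :
    (DD).totd n m h ((DD).totι n (n, 0) (by simp) a) =
      (DD).totι m (m, 0) (by simp) ((DD).dh (n, 0) (m, 0) a) +
      (DD).totι m (m - 1, 1) (by simp) ((DD).r (n, 0) (m - 1, 1) a) := by
  have e := (DD).totι_totd n m h n 0 (by simp) (n, -1) (m, 0) (m - 1, 1) (by simp)
    (by ext <;> simp; omega) (by ext <;> simp; omega)
  rw [totι_zero_of_rk lam eta phi m (n, -1) _ (rk_of_ne (by omega) (by omega)), Limits.comp_zero,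
    zero_add] at e
  exact congrArg (fun f : (DD).X (n, 0) ⟶ (DD).totX m => f a) e

theorem totd_totι_one (n m : ℤ) (h : m + 1 = n) (b : (DD).X (n - 1, 1)) :
    (DD).totd n m h ((DD).totι n (n - 1, 1) (by simp) b) =
      (DD).totι m (m, 0) (by simp) ((DD).dv (n - 1, 1) (m, 0) b) +
      (DD).totι m (m - 1, 1) (by simp) ((DD).dh (n - 1, 1) (m - 1, 1) b) := by
  have e := (DD).totι_totd n m h (n - 1) 1 (by simp) (m, 0) (m - 1, 1) (n - 3, 2)
    (by ext <;> simp; omega) (by ext <;> simp; omega) (by ext <;> simp; omega)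
  rw [totι_zero_of_rk lam eta phi m (n - 3, 2) _ (rk_of_ne (by omega) (by omega)),
    Limits.comp_zero, add_zero] at e
  exact congrArg (fun f : (DD).X (n - 1, 1) ⟶ (DD).totX m => f b) e

theorem isZero_totX {n : ℤ} (hn : n < 0) : IsZero ((DD).totX n) := by
  rw [IsZero.iff_id_eq_zero, totX_id, totι_zero_of_rk _ _ _ _ _ _ (rk_of_neg hn _),
    totι_zero_of_rk _ _ _ _ _ _ (rk_of_neg (by omega) _), Limits.comp_zero, Limits.comp_zero,
    add_zero]

theorem eq_zero_of_rk {a : ℤ × ℤ} (ha : rk a = 0) (w : (DD).X a) : w = 0 :=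
  congrArg (fun f : (DD).X a ⟶ (DD).X a => f w) (eq_zero_of_src lam eta phi ha (𝟙 _))

/-- The diagonal entries of `d^v` are right non-zero-divisors; the column `p = 0` is separate
because only one coordinate is present. -/
theorem dv_injective (p : ℤ) (m : ℤ × ℤ) (hm : m = (p, 0)) (w : (DD).X (p, 1))
    (hw : (DD).dv (p, 1) m w = 0) : w = 0 := by
  subst hm
  rcases lt_trichotomy p 0 with hp | rfl | hp
  · exact eq_zero_of_rk lam eta phi (rk_of_neg hp _) w
  · rw [dv_eq _ _ _ _ _ (by simp)] at hw
    change P lam eta phi (0, 1) at w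
    replace hw : rowMap lam eta phi (0, 1) (0, 0) (dvMat lam eta phi 0) w = 0 := hw
    rw [rowMap_apply, dvMat_zero, vecMul_fin_two] at hw
    have h0 := congrFun hw ⟨0, by simp [rk]⟩
    replace h0 : ext (0, 1) w 0 * _ + ext (0, 1) w 1 * 0 = 0 := h0
    rw [mul_zero, add_zero] at h0
    rw [← res_ext (0, 1) w]
    funext i
    obtain ⟨i, hi⟩ := i
    obtain rfl : i = 0 := by simpa [rk] using hi
    exact eq_zero_of_mul_sub lam eta phi _ _ h0
  · rw [dv_eq _ _ _ _ _ (by simp)] at hw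
    change P lam eta phi (p, 1) at w
    replace hw : rowMap lam eta phi (p, 1) (p, 0) (dvMat lam eta phi p) w = 0 := hw
    rw [rowMap_apply] at hw
    have h := congrArg (ext (p, 0)) hw
    rw [ext_res _ _ fun j hj => by rw [rk_of_pos (by omega) (.inl rfl)] at hj; omega] at h
    have h0 : ext (p, 0) (0 : P lam eta phi (p, 0)) = 0 := by funext j; simp [ext]
    have h := vecMul_dvMat_injective lam eta phi hp.ne' _ (h.trans h0)
    rw [← res_ext (p, 1) w, h]
    rfl

/-- A cycle of the total complex whose component in the row `q = 0` is a boundary modulo `dv` is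
a boundary. -/
theorem exists_totd_eq (n m : ℤ) (h : m + 1 = n) (a : (DD).X (n, 0)) (b : (DD).X (n - 1, 1))
    (ht : (DD).totd n m h ((DD).totι n (n, 0) (by simp) a +
      (DD).totι n (n - 1, 1) (by simp) b) = 0)
    (a' : (DD).X (n + 1, 0)) (b' : (DD).X (n + 1 - 1, 1))
    (ha : (DD).dh (n + 1, 0) (n, 0) a' + (DD).dv (n + 1 - 1, 1) (n, 0) b' = a) :
    ∃ t, (DD).totd (n + 1) n rfl t =
      (DD).totι n (n, 0) (by simp) a + (DD).totι n (n - 1, 1) (by simp) b := by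
  set t := (DD).totι (n + 1) (n + 1, 0) (by simp) a' +
    (DD).totι (n + 1) (n + 1 - 1, 1) (by simp) b' with ht'
  -- After subtracting the boundary of `(a', b')`, only `c` in the row `q = 1` remains. It is a
  -- cycle, so `d^v c = 0`, and injectivity of `d^v` gives `c = 0`.
  set c := b - ((DD).r (n + 1, 0) (n - 1, 1) a' + (DD).dh (n + 1 - 1, 1) (n - 1, 1) b') with hc
  have e : (DD).totι n (n, 0) (by simp) a + (DD).totι n (n - 1, 1) (by simp) b =
      (DD).totd (n + 1) n rfl t + (DD).totι n (n - 1, 1) (by simp) c := by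
    rw [ht', map_add, totd_totι_zero, totd_totι_one, hc, ← ha, map_sub, map_add, map_add]
    abel
  have hd : (DD).totd n m h ((DD).totd (n + 1) n rfl t) = 0 :=
    congrArg (fun f : (DD).totX (n + 1) ⟶ (DD).totX m => f t)
      ((DD).totd_totd (doubleData_isHomotopyDoubleComplex lam eta phi) (n + 1) n m rfl h)
  rw [e, map_add, hd, zero_add, totd_totι_one] at ht
  have h0 := totπ_totι_add lam eta phi m ((DD).dv (n - 1, 1) (m, 0) c)
    ((DD).dh (n - 1, 1) (m - 1, 1) c)
  rw [ht, map_zero] at h0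
  refine ⟨t, ?_⟩
  rw [e, dv_injective lam eta phi (n - 1) (m, 0) (by ext <;> simp; omega) c h0.symm, map_zero,
    add_zero]

theorem exists_dh_add_dv_eq {n m : ℤ} (h : m + 1 = n) (hn : 1 ≤ n) (a : (DD).X (n, 0))
    (b : (DD).X (n - 1, 1))
    (hab : (DD).dh (n, 0) (m, 0) a + (DD).dv (n - 1, 1) (m, 0) b = 0) :
    ∃ (a' : (DD).X (n + 1, 0)) (b' : (DD).X (n + 1 - 1, 1)),
      (DD).dh (n + 1, 0) (n, 0) a' + (DD).dv (n + 1 - 1, 1) (n, 0) b' = a := by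
  obtain rfl : m = n - 1 := by omega
  rw [dh_eq₀ _ _ _ _ _ rfl, dv_eq _ _ _ _ _ (by simp)] at hab
  change P lam eta phi (n, 0) at a
  change P lam eta phi (n - 1, 1) at b
  replace hab : rowMap lam eta phi (n, 0) (n - 1, 0) (dhMat₀ lam eta phi n) a +
    rowMap lam eta phi (n - 1, 1) (n - 1, 0) (dvMat lam eta phi (n - 1)) b = 0 := hab
  rw [rowMap_apply, rowMap_apply] at hab
  have hz : Matrix.vecMul (ext (n, 0) a) (dhMat₀ lam eta phi n) +
      Matrix.vecMul (ext (n - 1, 1) b) (dvMat lam eta phi (n - 1)) = 0 := by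
    funext j
    -- For `n = 1` the target has rank one; the padded coordinate vanishes because the second
    -- columns of both matrices do.
    by_cases hj : j.1 < rk (n - 1, 0)
    · exact congrFun hab ⟨j, hj⟩
    · rw [not_lt] at hj
      simp [Matrix.vecMul, dotProduct, dhMat₀_col lam eta phi hn rfl (.inl rfl) _ j hj,
        dvMat_col lam eta phi (show 0 ≤ n - 1 by omega) (.inl rfl) _ j hj]
  obtain ⟨w, v, hwv⟩ := exists_of_vecMul_dhMat₀ lam eta phi hn _ _ hz
  have hr : rk (n + 1 - 1, 1) = 2 := rk_of_pos (by omega) (.inr rfl)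
  refine ⟨res (n + 1, 0) w, res (n + 1 - 1, 1) v, ?_⟩
  rw [dh_eq₀ _ _ _ _ _ (by simp), dv_eq _ _ _ _ _ (by simp)]
  refine Eq.trans (b := res (n, 0) (Matrix.vecMul w (dhMat₀ lam eta phi (n + 1))) +
    res (n, 0) (Matrix.vecMul v (dvMat lam eta phi (n + 1 - 1)))) (congrArg₂ (· + ·)
      (rowMap_res (n + 1, 0) (n, 0) _ w ?_) (rowMap_res (n + 1 - 1, 1) (n, 0) _ v ?_)) ?_
  · intro j hj
    rw [rk_of_pos (by omega) (.inl rfl)] at hj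
    omega
  · intro j hj
    rw [hr] at hj
    omega
  · rw [add_sub_cancel_right]
    exact (congrArg (res (n, 0)) hwv).trans (res_ext (n, 0) a)

end total

/-! ### The augmentation of the total complex -/

section augmentation

local notation "DD" => doubleData lam eta phi

theorem linearCombination_one_apply (w : P lam eta phi (0, 0)) :
    Fintype.linearCombination (Env k (Alg lam eta phi))
      (fun _ : Fin (rk (0, 0)) => (1 : Alg lam eta phi)) w =
      ext (0, 0) w 0 • (1 : Alg lam eta phi) := by
  refine (Fintype.linearCombination_apply ..).trans ?_
  refine (Fintype.sum_eq_single (⟨0, by simp [rk]⟩ : Fin (rk (0, 0))) fun i hi => ?_).trans ?_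
  · have := i.2
    simp only [rk_zero_left (.inl rfl)] at this
    exact absurd (Fin.ext (by dsimp; omega)) hi
  · simp [ext, rk]

theorem bt_sub_bt_smul_one (c : Alg lam eta phi) :
    (bt k c 1 - bt k 1 c) • (1 : Alg lam eta phi) = 0 := by
  rw [sub_smul, bt, bt, env_smul_def, env_smul_def]
  simp only [mul_one, one_mul, sub_self]

theorem ext_rowMap_zero (a : ℤ × ℤ) (M : Matrix (Fin 2) (Fin 2) (Env k (Alg lam eta phi)))
    (w : P lam eta phi a) :
    ext (0, 0) (rowMap lam eta phi a (0, 0) M w) 0 = ext a w 0 * M 0 0 + ext a w 1 * M 1 0 := by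
  rw [rowMap_apply]
  simp [ext, res, rk, Matrix.vecMul, dotProduct, Fin.sum_univ_two]

theorem multMap_dh (a : (DD).X (1, 0)) :
    multMap lam eta phi ((DD).dh (1, 0) (0, 0) a) = 0 := by
  rw [dh_eq₀ _ _ _ _ _ (by simp)]
  change P lam eta phi (1, 0) at a
  refine (linearCombination_one_apply lam eta phi (rowMap lam eta phi (1, 0) (0, 0)
    (dhMat₀ lam eta phi 1) a)).trans ?_
  rw [ext_rowMap_zero, dhMat₀, if_pos rfl]
  change (ext (1, 0) a 0 * (bt k (gx lam eta phi) 1 - bt k 1 (gx lam eta phi)) +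
    ext (1, 0) a 1 * (bt k (gy lam eta phi) 1 - bt k 1 (gy lam eta phi))) •
      (1 : Alg lam eta phi) = 0
  rw [add_smul, mul_smul, mul_smul, bt_sub_bt_smul_one, bt_sub_bt_smul_one, smul_zero, smul_zero,
    add_zero]

theorem multMap_dv (b : (DD).X (1 - 1, 1)) :
    multMap lam eta phi ((DD).dv (1 - 1, 1) (0, 0) b) = 0 := by
  rw [dv_eq _ _ _ _ _ (by simp)]
  change P lam eta phi (1 - 1, 1) at b
  refine (linearCombination_one_apply lam eta phi (rowMap lam eta phi (1 - 1, 1) (0, 0)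
    (dvMat lam eta phi (1 - 1)) b)).trans ?_
  rw [ext_rowMap_zero,
    (congrArg (dvMat lam eta phi) (sub_self 1)).trans (dvMat_zero lam eta phi)]
  change (ext (1 - 1, 1) b 0 * (bt k (gz lam eta phi) 1 - bt k 1 (gz lam eta phi)) +
    ext (1 - 1, 1) b 1 * 0) • (1 : Alg lam eta phi) = 0
  rw [mul_zero, add_zero, mul_smul, bt_sub_bt_smul_one, smul_zero]

theorem exists_of_multMap_eq_zero (a : (DD).X (0, 0)) (ha : multMap lam eta phi a = 0) :
    ∃ (a' : (DD).X (0 + 1, 0)) (b' : (DD).X (0 + 1 - 1, 1)),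
      (DD).dh (0 + 1, 0) (0, 0) a' + (DD).dv (0 + 1 - 1, 1) (0, 0) b' = a := by
  obtain ⟨a₁, a₂, b, h⟩ := exists_of_smul_one_eq_zero lam eta phi (ext (0, 0) a 0)
    ((linearCombination_one_apply lam eta phi a).symm.trans ha)
  refine ⟨res (0 + 1, 0) ![a₁, a₂], res (0 + 1 - 1, 1) ![b, 0], ?_⟩
  rw [dh_eq₀ _ _ _ _ _ (by simp), dv_eq _ _ _ _ _ (by simp)]
  refine Eq.trans (b := res (0, 0) (Matrix.vecMul ![a₁, a₂] (dhMat₀ lam eta phi 1)) +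
    res (0, 0) (Matrix.vecMul ![b, 0] (dvMat lam eta phi 0))) (congrArg₂ (· + ·)
      (rowMap_res (0 + 1, 0) (0, 0) _ _ ?_) (rowMap_res (0 + 1 - 1, 1) (0, 0) _ _ ?_)) ?_
  · intro j hj
    rw [rk_of_pos (by omega) (.inl rfl)] at hj
    omega
  · intro j hj
    rw [show rk (0 + 1 - 1, 1) = 1 by simp [rk]] at hj
    obtain rfl : j = 1 := by omega
    rfl
  · rw [dhMat₀, if_pos rfl, dvMat_zero, vecMul_fin_two, vecMul_fin_two]
    refine Eq.trans ?_ (res_ext (0, 0) a)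
    funext i
    obtain ⟨i, hi⟩ := i
    obtain rfl : i = 0 := by simpa [rk] using hi
    refine Eq.trans ?_ h
    change (a₁ * _ + a₂ * _) + (b * _ + 0 * 0) = _
    rw [mul_zero, add_zero]

/-- The augmentation `Tot_0 → A`. -/
noncomputable def augmentation : (DD).totX 0 ⟶ algObj lam eta phi :=
  totπ lam eta phi 0 (0, 0) rfl ≫ multMap lam eta phi

theorem augmentation_apply (a : (DD).X (0, 0)) (b : (DD).X (0 - 1, 1)) :
    augmentation lam eta phi ((DD).totι 0 (0, 0) (by simp) a +
      (DD).totι 0 (0 - 1, 1) (by simp) b) = multMap lam eta phi a :=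
  congrArg (multMap lam eta phi) (totπ_totι_add lam eta phi 0 a b)

theorem totd_augmentation : (DD).totd 1 0 rfl ≫ augmentation lam eta phi = 0 := by
  refine ModuleCat.hom_ext (LinearMap.ext fun t => ?_)
  obtain ⟨a, b, rfl⟩ := exists_eq_totι_add lam eta phi 1 t
  change augmentation lam eta phi ((DD).totd 1 0 rfl _) = 0
  rw [map_add, totd_totι_zero, totd_totι_one, add_add_add_comm, ← map_add, ← map_add,
    augmentation_apply, map_add, multMap_dh, multMap_dv, add_zero]

end augmentation

end PolyGWA

/-- A coproduct of projective objects is projective. -/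
theorem projective_sigmaObj {C : Type*} [Category C] {β : Type*} (g : β → C) [HasCoproduct g]
    [∀ b, Projective (g b)] : Projective (∐ g) where
  factors f e _ := ⟨Sigma.desc fun b => Projective.factorThru (Sigma.ι g b ≫ f) e,
    Sigma.hom_ext _ _ fun b => by
      rw [Sigma.ι_desc_assoc, Projective.factorThru_comp]⟩

/-! ### The total complex is a projective resolution -/

namespace PolyGWA

variable {k : Type u} [Field k] (lam : kˣ) (eta : k) (phi : k[X])

local notation "DD" => doubleData lam eta phi
local notation "hDD" => doubleData_isHomotopyDoubleComplex lam eta phi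

theorem tot_d (n m : ℤ) (h : m + 1 = n) :
    ((DD).tot hDD).d n m = (DD).totd n m h :=
  dif_pos h

theorem free_X (a : ℤ × ℤ) : Module.Free (Env k (Alg lam eta phi)) ((DD).X a) :=
  inferInstanceAs (Module.Free (Env k (Alg lam eta phi)) (P lam eta phi a))

theorem projective_totX (n : ℤ) : Projective ((DD).totX n) := by
  have (a : {a : ℤ × ℤ // a.1 + a.2 = n}) : Projective ((DD).X a.1) :=
    ModuleCat.projective_of_free (Pi.basisFun (Env k (Alg lam eta phi)) (Fin (rk a.1)))
  exact projective_sigmaObj (fun a : {a : ℤ × ℤ // a.1 + a.2 = n} => (DD).X a.1)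

/-- The augmentation as a morphism of complexes. -/
noncomputable def totAugmentation : (DD).tot hDD ⟶
    (HomologicalComplex.single (ModuleCat.{u} (Env k (Alg lam eta phi)))
      (ComplexShape.down ℤ) 0).obj (algObj lam eta phi) :=
  HomologicalComplex.mkHomToSingle (augmentation lam eta phi) fun i hi => by
    obtain rfl : 1 = i := by simpa using hi
    rw [tot_d lam eta phi 1 0 rfl]
    exact totd_augmentation lam eta phi

theorem totAugmentation_f : (totAugmentation lam eta phi).f 0 = augmentation lam eta phi ≫
    (HomologicalComplex.singleObjXSelf (ComplexShape.down ℤ) 0 (algObj lam eta phi)).inv :=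
  HomologicalComplex.mkHomToSingle_f ..

theorem exists_totd_of_totd_eq_zero {n m : ℤ} (h : m + 1 = n) (hn : 1 ≤ n) (t : (DD).totX n)
    (ht : (DD).totd n m h t = 0) : ∃ t', (DD).totd (n + 1) n rfl t' = t := by
  obtain ⟨a, b, rfl⟩ := exists_eq_totι_add lam eta phi n t
  have ha : (DD).dh (n, 0) (m, 0) a + (DD).dv (n - 1, 1) (m, 0) b = 0 := by
    have h0 := congrArg (totπ lam eta phi m (m, 0) (by simp)) ht
    rwa [map_add, totd_totι_zero, totd_totι_one, add_add_add_comm, ← map_add, ← map_add,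
      totπ_totι_add, map_zero] at h0
  obtain ⟨a', b', e⟩ := exists_dh_add_dv_eq lam eta phi h hn a b ha
  exact exists_totd_eq lam eta phi n m h a b ht a' b' e

theorem exists_totd_of_augmentation_eq_zero (t : (DD).totX 0)
    (ht : augmentation lam eta phi t = 0) : ∃ t', (DD).totd (0 + 1) 0 rfl t' = t := by
  obtain ⟨a, b, rfl⟩ := exists_eq_totι_add lam eta phi 0 t
  rw [augmentation_apply] at ht
  obtain ⟨a', b', e⟩ := exists_of_multMap_eq_zero lam eta phi a ht
  -- In degree `0` the cycle condition is automatic because `Tot_{-1} = 0`, so the chase used in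
  -- positive degrees applies unchanged.
  refine exists_totd_eq lam eta phi 0 (-1) (by simp) a b ?_ a' b' e
  exact congrArg (fun f : (DD).totX 0 ⟶ (DD).totX (-1) =>
    f ((DD).totι 0 (0, 0) (by simp) a + (DD).totι 0 (0 - 1, 1) (by simp) b))
    ((isZero_totX lam eta phi (by simp : (-1 : ℤ) < 0)).eq_zero_of_tgt
      ((DD).totd 0 (-1) (by simp)))

theorem augmentation_surjective : Function.Surjective (augmentation lam eta phi) := by
  intro c
  change Alg lam eta phi at c
  refine ⟨(DD).totι 0 (0, 0) (by simp) (res (0, 0) ![bt k c 1, 0]) +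
    (DD).totι 0 (0 - 1, 1) (by simp) 0, ?_⟩
  refine (augmentation_apply lam eta phi _ _).trans ?_
  refine (linearCombination_one_apply lam eta phi (res (0, 0) ![bt k c 1, 0])).trans ?_
  rw [ext_res]
  · change bt k c 1 • (1 : Alg lam eta phi) = c
    rw [bt, env_smul_def, mul_one, mul_one]
  · intro j hj
    rw [rk_zero_left (.inl rfl)] at hj
    obtain rfl : j = 1 := by omega
    rfl

theorem exactAt_tot {n : ℤ} (hn : n ≠ 0) : ((DD).tot hDD).ExactAt n := by
  rcases lt_or_gt_of_ne hn with hn | hn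
  · exact ShortComplex.exact_of_isZero_X₂ _ (isZero_totX lam eta phi hn)
  · rw [HomologicalComplex.exactAt_iff' _ (n + 1) n (n - 1) (by simp) (by simp),
      ShortComplex.moduleCat_exact_iff]
    intro t ht
    change ((DD).tot hDD).d n (n - 1) t = 0 at ht
    rw [tot_d lam eta phi n (n - 1) (by simp)] at ht
    obtain ⟨t', ht'⟩ := exists_totd_of_totd_eq_zero lam eta phi _ (by omega) t ht
    refine ⟨t', ?_⟩
    change ((DD).tot hDD).d (n + 1) n t' = t
    rw [tot_d lam eta phi (n + 1) n rfl]
    exact ht'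

/-- As `Tot_{-1}` and the neighbouring terms of the single complex vanish, the claim amounts to
exactness of `Tot_1 → Tot_0 → A` and surjectivity of the augmentation. -/
theorem quasiIsoAt_zero : QuasiIsoAt (totAugmentation lam eta phi) 0 := by
  rw [quasiIsoAt_iff' _ 1 0 (-1) (by simp) (by simp), ShortComplex.quasiIso_iff_of_zeros']
  · constructor
    · rw [ShortComplex.moduleCat_exact_iff]
      intro t ht
      change (totAugmentation lam eta phi).f 0 t = 0 at ht
      rw [totAugmentation_f] at ht
      have h0 := congrArg (HomologicalComplex.singleObjXSelf (ComplexShape.down ℤ) 0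
        (algObj lam eta phi)).hom ht
      rw [map_zero] at h0
      have h1 : augmentation lam eta phi t = 0 := by
        refine Eq.trans ?_ h0
        exact congrArg (fun f : algObj lam eta phi ⟶ algObj lam eta phi =>
          f (augmentation lam eta phi t)) (Iso.inv_hom_id (HomologicalComplex.singleObjXSelf
            (ComplexShape.down ℤ) 0 (algObj lam eta phi))).symm
      obtain ⟨t', ht'⟩ := exists_totd_of_augmentation_eq_zero lam eta phi t h1
      refine ⟨t', ?_⟩
      change ((DD).tot hDD).d 1 0 t' = t
      rw [tot_d lam eta phi 1 0 rfl]
      exact ht'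
    · change Epi ((totAugmentation lam eta phi).f 0)
      rw [totAugmentation_f]
      have : Epi (augmentation lam eta phi) :=
        (ModuleCat.epi_iff_surjective _).mpr (augmentation_surjective lam eta phi)
      exact epi_comp (augmentation lam eta phi) (HomologicalComplex.singleObjXSelf
        (ComplexShape.down ℤ) 0 (algObj lam eta phi)).inv
  · exact (isZero_totX lam eta phi (by simp : (-1 : ℤ) < 0)).eq_zero_of_tgt _
  · simp; rfl
  · simp; rfl

theorem isProjectiveResolution_tot :
    IsProjectiveResolution ((DD).tot hDD) (totAugmentation lam eta phi) where
  projective := projective_totX lam eta phi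
  isZero _ hn := isZero_totX lam eta phi hn
  quasiIso := ⟨fun n => by
    by_cases hn : n = 0
    · subst hn
      exact quasiIsoAt_zero lam eta phi
    · rw [quasiIsoAt_iff_exactAt _ _ (exactAt_tot lam eta phi hn)]
      exact HomologicalComplex.exactAt_single_obj _ _ _ _ hn⟩

end PolyGWA

theorem mainTheorem9 {k : Type u} [Field k] (lam : kˣ) (eta : k) (phi : k[X]) (hphi : phi ≠ 0) :
    (∀ a : ℤ × ℤ, Module.Free (Env k (PolyGWA.Alg lam eta phi))
      ((PolyGWA.doubleData lam eta phi).X a)) ∧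
    ∃ hD : (PolyGWA.doubleData lam eta phi).IsHomotopyDoubleComplex,
      ∃ π : (PolyGWA.doubleData lam eta phi).tot hD ⟶
          (HomologicalComplex.single (ModuleCat.{u} (Env k (PolyGWA.Alg lam eta phi)))
            (ComplexShape.down ℤ) 0).obj (PolyGWA.algObj lam eta phi),
        (PolyGWA.doubleData lam eta phi).totι 0 (0, 0) rfl ≫ π.f 0 ≫
            (HomologicalComplex.singleObjXSelf (ComplexShape.down ℤ) 0
              (PolyGWA.algObj lam eta phi)).hom = PolyGWA.multMap lam eta phi ∧
        IsProjectiveResolution ((PolyGWA.doubleData lam eta phi).tot hD) π := by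
  refine ⟨PolyGWA.free_X lam eta phi, PolyGWA.doubleData_isHomotopyDoubleComplex lam eta phi,
    PolyGWA.totAugmentation lam eta phi, ?_, PolyGWA.isProjectiveResolution_tot lam eta phi⟩
  rw [PolyGWA.totAugmentation_f]
  refine (congrArg ((PolyGWA.doubleData lam eta phi).totι 0 (0, 0) rfl ≫ ·)
    ((Category.assoc _ _ _).trans ((congrArg (PolyGWA.augmentation lam eta phi ≫ ·)
      (Iso.inv_hom_id _)).trans (Category.comp_id _)))).trans ?_
  refine (Category.assoc _ _ _).symm.trans ?_
  rw [PolyGWA.totι_totπ]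
  exact Category.id_comp _
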